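/- **Setting.** Let $k$ be a field, $\hat{\mathsf G}$ a finite group with a surjective homomorphism $\pi:\hat{\mathsf G}\to\{\pm1\}$, $\mathsf G=\ker\pi$, and let $\hat\alpha\in Z^3(B\hat{\mathsf G},k^\times_\pi)$ be a normalized twisted cocycle, i.e. $\hat\alpha([\omega_3|\omega_2|\omega_1])=1$ if some $\omega_i=1$ and $$\hat\alpha([\omega_4\omega_3|\omega_2|\omega_1])\,\hat\alpha([\omega_4|\omega_3|\omega_2\omega_1])=\hat\alpha([\omega_3|\omega_2|\omega_1])^{\pi(\omega_4)}\,\hat\alpha([\omega_4|\omega_3\omega_2|\omega_1])\,\hat\alpha([\omega_4|\omega_3|\omega_2]).$$ For a category $V$ put ${}^{+}V=V$ and ${}^{-}V=V^{\mathrm{op}}$. An *$\hat\alpha$-twisted Real $2$-representation* on a $k$-linear category $V$ consists of $k$-linear functors $\rho(\omega):{}^{\pi(\omega)}V\to V$ $(\omega\in\hat{\mathsf G})$ and natural isomorphisms $\psi_{\omega_2,\omega_1}:\rho(\omega_2)\circ{}^{\pi(\omega_2)}\rho(\omega_1)\Rightarrow\rho(\omega_2\omega_1)$ and $\psi_e:\rho(1)\Rightarrow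 1_V$ with $$\hat\alpha([\omega_3|\omega_2|\omega_1])\,\psi_{\omega_3\omega_2,\omega_1}\circ(\psi_{\omega_3,\omega_2}\rho(\omega_1))=\psi_{\omega_3,\omega_2\omega_1}\circ\rho(\omega_3)(\psi_{\omega_2,\omega_1}^{\pi(\omega_3)}),\quad \psi_{1,\omega}=\psi_e\,\rho(\omega),\quad \psi_{\omega,1}=\rho(\omega)(\psi_e^{\pi(\omega)}).$$ For a group $\mathsf H$ with trivial grading and $\alpha\in Z^3(B\mathsf H,k^\times)$ this is a linear representation of the categorical group $\mathcal H=\mathcal G(\mathsf H,\alpha)$. **Characters.** For $g\in\mathsf G$ let $\mathbb{T}\mathrm{r}_\rho(g)=\mathrm{Nat}(1_V,\rho(g))$. For $\omega\in\hat{\mathsf G}$ and $g'=\omega g^{\pi(\omega)}\omega^{-1}$, the linear map $\beta_{g,\omega}:\mathbb{T}\mathrm{r}_\rho(g)\to\mathbb{T}\mathrm{r}_\rho(g')$ sends $\phi$ to the transformation with component at $x$ $$x\to\rho(\omega)\rho(\omega^{-1})x\to\rho(\omega)\rho(g^{\pi(\omega)})\rho(\omega^{-1})x\to\rho(\omega g^{\pi(\omega)})\rho(\omega^{-1})x\to\rho(g')\rho(\omega)\rho(\omega^{-1})x\to\rho(g')x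 .$$ The first and last maps are given by $\psi_{\omega,\omega^{-1}}$ and $\psi_e$, the third by $\psi_{\omega,g^{\pi(\omega)}}$, the fourth by $\psi_{g',\omega}^{-1}$. The second map is $\rho(\omega)(\phi)$ if $\pi(\omega)=1$; if $\pi(\omega)=-1$ it is the value of the contravariant functor $\rho(\omega)$ on the composite $\rho(g^{-1})\xrightarrow{\rho(g^{-1})\phi}\rho(g^{-1})\rho(g)\xrightarrow{\psi_{g^{-1},g}}\rho(1)\xrightarrow{\psi_e}1_V$. If $g\in\mathsf G$, $\omega\in\hat{\mathsf G}$ satisfy $\omega g^{\pi(\omega)}=g\omega$ (a graded commuting pair) and $\mathbb{T}\mathrm{r}_\rho(g)$ is finite dimensional, the Real $2$-character is $\chi_\rho(g,\omega)=\mathrm{tr}(\beta_{g,\omega}\mid\mathbb{T}\mathrm{r}_\rho(g))$. **Induction.** Let $\mathsf H\le\mathsf G$ and let $\rho$ be a linear representation of $\mathcal H=\mathcal G(\mathsf H,\hat\alpha|_{\mathsf H})$ on a $k$-linear category $V$. Choose representatives $r_i$ of $\mathsf G/\mathsf H$. The representation $\mathrm{Ind}_{\mathcal H}^{\mathcal G}(\rho)$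 acts on $\prod_{\mathsf G/\mathsf H}V$ by $(g\cdot x)_j=\rho(h)(x_i)$ for $gr_i=r_jh$, $h\in\mathsf H$; if $g_1r_i=r_jh_1$ and $g_2r_j=r_lh_2$, the $l$-th component of $\mathrm{Ind}(\psi)_{g_2,g_1}$ is $$\frac{\hat\alpha([g_2|r_j|h_1])}{\hat\alpha([g_2|g_1|r_i])\,\hat\alpha([r_l|h_2|h_1])}\,\psi_{h_2,h_1},$$ and $\mathrm{Ind}(\psi)_e$ is $\psi_e$ in each component. Choose $\varsigma\in\hat{\mathsf G}\setminus\mathsf G$. For a linear representation $\rho$ of $\mathcal G=\mathcal G(\mathsf G,\hat\alpha|_{\mathsf G})$ on $W$, the Real $2$-representation $\mathrm{HInd}_{\mathcal G}^{\hat{\mathcal G}}(\rho)$ acts on $W\times W^{\mathrm{op}}$ by $g\cdot(x,y)=(\rho(g)x,\rho(\varsigma^{-1}g\varsigma)y)$ for $g\in\mathsf G$ and $\omega\cdot(x,y)=(\rho(\omega\varsigma)y,\rho(\varsigma^{-1}\omega)x)$ for $\omega\in\hat{\mathsf G}\setminus\mathsf G$. Writing $g'=\varsigma^{-1}g\varsigma$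 and $\psi^{-\mathrm{op}}$ for the inverse of $\psi$ viewed in $W^{\mathrm{op}}$, its coherence isomorphisms (first component; second component) are, for $g_i\in\mathsf G$ and $\omega_i\in\hat{\mathsf G}\setminus\mathsf G$, - $(g_2,g_1)$: $\ \psi_{g_2,g_1}$; $\ \dfrac{\hat\alpha([g_2|\varsigma|g_1'])}{\hat\alpha([g_2|g_1|\varsigma])\hat\alpha([\varsigma|g_2'|g_1'])}\,\psi^{-\mathrm{op}}_{g_2',g_1'}$ - $(\omega_2,g_1)$: $\ \dfrac{\hat\alpha([\omega_2|\varsigma|g_1'])}{\hat\alpha([\omega_2|g_1|\varsigma])}\,\psi_{\omega_2\varsigma,g_1'}$; $\ \hat\alpha([\varsigma|\varsigma^{-1}\omega_2|g_1])^{-1}\,\psi^{-\mathrm{op}}_{\varsigma^{-1}\omega_2,g_1}$ - $(g_2,\omega_1)$: $\ \hat\alpha([g_2|\omega_1|\varsigma])^{-1}\,\psi_{g_2,\omega_1\varsigma}$; $\ \dfrac{\hat\alpha([g_2|\varsigma|\varsigma^{-1}\omega_1])}{\hat\alpha([\varsigma|g_2'|\varsigma^{-1}\omega_1])}\,\psi^{-\mathrm{op}}_{g_2',\varsigma^{-1}\omega_1}$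 - $(\omega_2,\omega_1)$: $\ \hat\alpha([\omega_2|\varsigma|\varsigma^{-1}\omega_1])\,\psi_{\omega_2\varsigma,\varsigma^{-1}\omega_1}$; $\ \dfrac{1}{\hat\alpha([\omega_2|\omega_1|\varsigma])\hat\alpha([\varsigma|\varsigma^{-1}\omega_2|\omega_1\varsigma])}\,\psi^{-\mathrm{op}}_{\varsigma^{-1}\omega_2,\omega_1\varsigma}$ together with $(\psi_e;\psi_e^{-\mathrm{op}})$. Set $\mathrm{HInd}_{\mathcal H}^{\hat{\mathcal G}}=\mathrm{HInd}_{\mathcal G}^{\hat{\mathcal G}}\circ\mathrm{Ind}_{\mathcal H}^{\mathcal G}$. **Transgression.** For $g\in\mathsf G$, $\omega_1,\omega_2\in\hat{\mathsf G}$ put $$\tau_\pi^{\mathrm{ref}}(\hat\alpha)([\omega_2|\omega_1]g)=\hat\alpha([g|g^{-1}|g])^{\delta}\left(\frac{\hat\alpha([\omega_1g^{-\pi(\omega_1)}\omega_1^{-1}|\omega_1g^{\pi(\omega_1)}\omega_1^{-1}|\omega_1])\,\hat\alpha([\omega_1|g^{-\pi(\omega_1)}|g^{\pi(\omega_1)}])}{\hat\alpha([\omega_1g^{-\pi(\omega_1)}\omega_1^{-1}|\omega_1|g^{\pi(\omega_1)}])}\right)^{\frac{\pi(\omega_2)-1}2}\frac{\hat\alpha([\omega_2|\omega_1|g^{\pi(\omega_2\omega_1)}])\,\hat\alpha([\omega_2\omega_1g^{\pi(\omega_2\omega_1)}(\omega_2\omega_1)^{-1}|\omega_2|\omega_1])}{\hat\alpha([\omega_2|\omega_1g^{\pi(\omega_2\omega_1)}\omega_1^{-1}|\omega_1])},$$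 with $\delta=1$ if $\pi(\omega_1)=\pi(\omega_2)=-1$ and $\delta=0$ otherwise, and for a graded commuting pair $(g,\omega)$ and $\sigma\in\hat{\mathsf G}$ put $$\tau\tau_\pi^{\mathrm{ref}}(\hat\alpha)([\sigma]g\xrightarrow{\omega}g)=\frac{\tau_\pi^{\mathrm{ref}}(\hat\alpha)([\sigma\omega\sigma^{-1}|\sigma]g)}{\tau_\pi^{\mathrm{ref}}(\hat\alpha)([\sigma|\omega]g)}.$$ **Theorem.** Let $\mathsf H\le\mathsf G$ and let $\rho$ be a linear representation of $\mathcal H$ on a $k$-linear category $V$ such that $\mathbb{T}\mathrm{r}_\rho(h)$ is finite dimensional for every $h\in\mathsf H$. Then, for every choice of $\varsigma$ and of coset representatives: 1. the spaces $\mathbb{T}\mathrm{r}_{\mathrm{HInd}_{\mathcal H}^{\hat{\mathcal G}}(\rho)}(g)$, $g\in\mathsf G$, are finite dimensional, so that the Real $2$-character of $\mathrm{HInd}_{\mathcal H}^{\hat{\mathcal G}}(\rho)$ is defined; 2. if $|\mathsf H|$ is invertible in $k$, then for every graded commuting pair $(g,\omega)$ $$\chi_{\mathrm{HInd}_{\mathcal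 H}^{\hat{\mathcal G}}(\rho)}(g,\omega)=\frac1{|\mathsf H|}\sum_{\substack{\sigma\in\hat{\mathsf G}\\ \sigma g^{\pi(\sigma)}\sigma^{-1},\ \sigma\omega\sigma^{-1}\in\mathsf H}}\tau\tau_\pi^{\mathrm{ref}}(\hat\alpha)([\sigma]g\xrightarrow{\omega}g)^{-1}\cdot\chi_\rho(\sigma g^{\pi(\sigma)}\sigma^{-1},\sigma\omega\sigma^{-1});$$ 3. (over any $k$) the character is supported on $\pi_0(\Lambda^2B\mathsf G)\subset\pi_0(\Lambda\Lambda_\pi^{\mathrm{ref}}B\hat{\mathsf G})$: if $(g,\omega)$ is a graded commuting pair with $\chi_{\mathrm{HInd}_{\mathcal H}^{\hat{\mathcal G}}(\rho)}(g,\omega)\ne0$, then $\omega\in\mathsf G$. -/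

import Mathlib

open CategoryTheory Opposite

universe w v u

namespace RealTwoRep

/-! ### Products and opposites of `k`-linear categories -/

section LinearCategories

variable {k : Type*} [Field k] {C : Type*} [Category C] [Preadditive C] [Linear k C]
  {D : Type*} [Category D] [Preadditive D] [Linear k D] {ι : Type*}

instance linearOpposite : Linear k Cᵒᵖ where
  homModule X Y :=
    { smul := fun a f => (a • f.unop).op
      one_smul := fun f => Quiver.Hom.unop_inj (one_smul k f.unop)
      mul_smul := fun a b f => Quiver.Hom.unop_inj (mul_smul a b f.unop)
      smul_zero := fun a => Quiver.Hom.unop_inj (smul_zero (A := Y.unop ⟶ X.unop) a)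
      smul_add := fun a f g => Quiver.Hom.unop_inj (smul_add a f.unop g.unop)
      add_smul := fun a b f => Quiver.Hom.unop_inj (add_smul a b f.unop)
      zero_smul := fun f => Quiver.Hom.unop_inj (zero_smul k f.unop) }
  smul_comp _ _ _ a f g := Quiver.Hom.unop_inj (Linear.comp_smul _ _ _ g.unop a f.unop)
  comp_smul _ _ _ f a g := Quiver.Hom.unop_inj (Linear.smul_comp _ _ _ a g.unop f.unop)

instance preadditivePi : Preadditive (ι → C) where
  homGroup X Y := inferInstanceAs (AddCommGroup (∀ i, X i ⟶ Y i))
  add_comp _ _ _ _ _ _ := funext fun _ => Preadditive.add_comp _ _ _ _ _ _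
  comp_add _ _ _ _ _ _ := funext fun _ => Preadditive.comp_add _ _ _ _ _ _

instance linearPi : Linear k (ι → C) where
  homModule X Y := inferInstanceAs (Module k (∀ i, X i ⟶ Y i))
  smul_comp _ _ _ _ _ _ := funext fun _ => Linear.smul_comp _ _ _ _ _ _
  comp_smul _ _ _ _ _ _ := funext fun _ => Linear.comp_smul _ _ _ _ _ _

instance preadditiveProd : Preadditive (C × D) where
  homGroup X Y := inferInstanceAs (AddCommGroup ((X.1 ⟶ Y.1) × (X.2 ⟶ Y.2)))
  add_comp _ _ _ _ _ _ := Prod.ext (Preadditive.add_comp _ _ _ _ _ _)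
    (Preadditive.add_comp _ _ _ _ _ _)
  comp_add _ _ _ _ _ _ := Prod.ext (Preadditive.comp_add _ _ _ _ _ _)
    (Preadditive.comp_add _ _ _ _ _ _)

instance linearProd : Linear k (C × D) where
  homModule X Y := inferInstanceAs (Module k ((X.1 ⟶ Y.1) × (X.2 ⟶ Y.2)))
  smul_comp _ _ _ _ _ _ := Prod.ext (Linear.smul_comp _ _ _ _ _ _)
    (Linear.smul_comp _ _ _ _ _ _)
  comp_smul _ _ _ _ _ _ := Prod.ext (Linear.comp_smul _ _ _ _ _ _)
    (Linear.comp_smul _ _ _ _ _ _)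

@[simp] lemma unop_smul' {X Y : Cᵒᵖ} (a : k) (f : X ⟶ Y) : (a • f).unop = a • f.unop := rfl
@[simp] lemma op_smul' {X Y : C} (a : k) (f : X ⟶ Y) : (a • f).op = a • f.op := rfl
@[simp] lemma pi_add_apply {X Y : ι → C} (f g : X ⟶ Y) (i : ι) : (f + g) i = f i + g i := rfl
@[simp] lemma pi_smul_apply {X Y : ι → C} (a : k) (f : X ⟶ Y) (i : ι) :
    (a • f) i = a • f i := rfl
@[simp] lemma prod_add_fst {X Y : C × D} (f g : X ⟶ Y) : (f + g).1 = f.1 + g.1 := rfl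
@[simp] lemma prod_add_snd {X Y : C × D} (f g : X ⟶ Y) : (f + g).2 = f.2 + g.2 := rfl
@[simp] lemma prod_smul_fst {X Y : C × D} (a : k) (f : X ⟶ Y) : (a • f).1 = a • f.1 := rfl
@[simp] lemma prod_smul_snd {X Y : C × D} (a : k) (f : X ⟶ Y) : (a • f).2 = a • f.2 := rfl

/-- An isomorphism rescaled by a unit of the ground field. -/
@[simps] def scaleIso {X Y : C} (c : kˣ) (e : X ≅ Y) : X ≅ Y where
  hom := (c : k) • e.hom
  inv := ((c⁻¹ : kˣ) : k) • e.inv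
  hom_inv_id := by simp [smul_smul]
  inv_hom_id := by simp [smul_smul]

end LinearCategories

/-! ### Twisted 3-cocycles -/

/-- The group of normalized cocycles `Z³(BΓ, kˣ_π)`, where `ω ∈ Γ` acts on `kˣ` by
`a ↦ a ^ π(ω)`. The value `α ω₃ ω₂ ω₁` is `α([ω₃|ω₂|ω₁])`. For `π = 1` these are the ordinary
normalized 3-cocycles of `Γ`. -/
structure TwistedCocycle {Γ : Type*} [Group Γ] (k : Type*) [Field k] (π : Γ →* ℤˣ) where
  toFun : Γ → Γ → Γ → kˣ
  cocycle : ∀ ω₄ ω₃ ω₂ ω₁,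
    toFun (ω₄ * ω₃) ω₂ ω₁ * toFun ω₄ ω₃ (ω₂ * ω₁) =
      toFun ω₃ ω₂ ω₁ ^ ((π ω₄ : ℤˣ) : ℤ) * toFun ω₄ (ω₃ * ω₂) ω₁ * toFun ω₄ ω₃ ω₂
  one_left : ∀ b c, toFun 1 b c = 1
  one_mid : ∀ a c, toFun a 1 c = 1
  one_right : ∀ a b, toFun a b 1 = 1

attribute [simp] TwistedCocycle.one_left TwistedCocycle.one_mid TwistedCocycle.one_right

section Cocycles

variable {k : Type*} [Field k] {Γ : Type*} [Group Γ] {π : Γ →* ℤˣ}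

instance : CoeFun (TwistedCocycle k π) fun _ => Γ → Γ → Γ → kˣ := ⟨TwistedCocycle.toFun⟩

/-- The restriction of a twisted cocycle to a subgroup of the ungraded group `ker π`. -/
@[simps] def TwistedCocycle.res (α : TwistedCocycle k π) {H : Subgroup Γ} (hH : H ≤ π.ker) :
    TwistedCocycle k (1 : H →* ℤˣ) where
  toFun a b c := α a b c
  cocycle a b c d := by
    have h := α.cocycle a b c d
    rw [show π a = 1 from hH a.2] at h
    simpa using h
  one_left _ _ := α.one_left _ _
  one_mid _ _ := α.one_mid _ _
  one_right _ _ := α.one_right _ _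

/-- The scalar `α([ω₂|s₁|η₁]) / (α([ω₂|ω₁|s₀]) α([s₂|η₂|η₁]))` attached to
`ω₁ s₀ = s₁ η₁` and `ω₂ s₁ = s₂ η₂`. -/
def TwistedCocycle.coeff (α : TwistedCocycle k π) (ω₂ ω₁ s₂ s₁ s₀ η₂ η₁ : Γ) : kˣ :=
  α ω₂ s₁ η₁ / (α ω₂ ω₁ s₀ * α s₂ η₂ η₁)

lemma TwistedCocycle.coeff_assoc (α : TwistedCocycle k π)
    {ω₃ ω₂ ω₁ s₃ s₂ s₁ s₀ η₃ η₂ η₁ : Γ}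
    (e₁ : ω₁ * s₀ = s₁ * η₁) (e₂ : ω₂ * s₁ = s₂ * η₂) (e₃ : ω₃ * s₂ = s₃ * η₃) :
    α ω₃ ω₂ ω₁ * α.coeff ω₃ ω₂ s₃ s₂ s₁ η₃ η₂ * α.coeff (ω₃ * ω₂) ω₁ s₃ s₁ s₀ (η₃ * η₂) η₁ =
      α η₃ η₂ η₁ ^ ((π s₃ : ℤˣ) : ℤ) * α.coeff ω₂ ω₁ s₂ s₁ s₀ η₂ η₁ ^ ((π ω₃ : ℤˣ) : ℤ) *
        α.coeff ω₃ (ω₂ * ω₁) s₃ s₂ s₀ η₃ (η₂ * η₁) := by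
  have h₁ := congrArg Additive.ofMul (α.cocycle ω₃ ω₂ ω₁ s₀)
  have h₂ := congrArg Additive.ofMul (α.cocycle ω₃ ω₂ s₁ η₁)
  have h₃ := congrArg Additive.ofMul (α.cocycle ω₃ s₂ η₂ η₁)
  have h₄ := congrArg Additive.ofMul (α.cocycle s₃ η₃ η₂ η₁)
  rw [e₁] at h₁
  rw [e₂] at h₂
  rw [e₃] at h₃
  apply Additive.ofMul.injective
  simp only [coeff, ofMul_mul, ofMul_div, ofMul_zpow] at *
  linear_combination (norm := module) h₂ - h₁ - h₃ + h₄

end Cocycles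
/-! ### Twisted Real 2-representations on a linear category -/

/-- The degrees `+1` and `-1`. -/
inductive Parity
  | even
  | odd

/-- The degree as an element of `ℤ₂ = {±1}`. -/
def Parity.sign : Parity → ℤˣ
  | .even => 1
  | .odd => -1

lemma sign_one {Γ : Type*} [Group Γ] (π : Γ →* ℤˣ) : π 1 = Parity.even.sign := map_one π

lemma sign_inv {Γ : Type*} [Group Γ] {π : Γ →* ℤˣ} {ω : Γ} {ε : Parity} (h : π ω = ε.sign) :
    π ω⁻¹ = ε.sign := by
  rw [map_inv, h, Int.units_inv_eq_self]

/-- Functors `{}^εV ⥤ V`: a covariant endofunctor of `V` for `ε = 1`, a functor `Vᵒᵖ ⥤ V` for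
`ε = -1`. -/
def SignedEnd (V : Type u) [Category.{v} V] : Parity → Type (max u v)
  | .even => V ⥤ V
  | .odd => Vᵒᵖ ⥤ V

namespace SignedEnd

variable {V : Type u} [Category.{v} V]

/-- A signed endofunctor of degree `1` as a functor. -/
def cov (F : SignedEnd V .even) : V ⥤ V := F

/-- A signed endofunctor of degree `-1` as a functor. -/
def contra (F : SignedEnd V .odd) : Vᵒᵖ ⥤ V := F

/-- The action on objects. -/
def obj : {ε : Parity} → SignedEnd V ε → V → V
  | .even, F, x => F.cov.obj x
  | .odd, F, x => F.contra.obj (op x)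

/-- The value of a signed endofunctor `F` of degree `ε` on `e ^ ε`, for an isomorphism `e`. -/
def mapIso : {ε : Parity} → (F : SignedEnd V ε) → {x y : V} → (x ≅ y) → (F.obj x ≅ F.obj y)
  | .even, F, _, _, e => F.cov.mapIso e
  | .odd, F, _, _, e => F.contra.mapIso e.symm.op

/-- `k`-linearity of a signed endofunctor. -/
def IsLinear (k : Type*) [Field k] [Preadditive V] [Linear k V] :
    {ε : Parity} → SignedEnd V ε → Prop
  | .even, F => F.cov.Additive ∧ F.cov.Linear k
  | .odd, F => F.contra.Additive ∧ F.contra.Linear k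

end SignedEnd

/-- An `α`-twisted Real 2-representation on a `k`-linear category `V`, for the group `Γ` with
grading `π` and `α ∈ Z³(BΓ, kˣ_π)`; equivalently, a linear Real representation on `V` of the
categorical group `𝒢(ker π, α)` with Real structure `𝒢(Γ, α)`.

* `act` is the family of `k`-linear functors `ρ(ω) : {}^{π(ω)}V ⥤ V`. They are automatically
  equivalences, by the other data.
* `ψ` is the family of natural isomorphisms
  `ψ_{ω₂,ω₁} : ρ(ω₂) ∘ {}^{π(ω₂)}ρ(ω₁) ⟹ ρ(ω₂ω₁)`, given by their components at the objects of
  `V`. To avoid transport along equations, the target is indexed by an element `ω` with a proof of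
  `ω₂ω₁ = ω`, and degrees are indexed by a parity `ε` with a proof of `π(ω) = ε`.
* `ψe` is the natural isomorphism `ρ(1) ⟹ 1_V`.

For `π = 1` this is a linear representation of the categorical group `𝒢(Γ, α)`. -/
structure TwistedRep {k : Type*} [Field k] {Γ : Type*} [Group Γ] (π : Γ →* ℤˣ)
    (α : TwistedCocycle k π) (V : Type u) [Category.{v} V] [Preadditive V] [Linear k V] where
  act : ∀ {ε : Parity} {ω : Γ}, π ω = ε.sign → SignedEnd V ε
  linear : ∀ {ε : Parity} {ω : Γ} (h : π ω = ε.sign), (act h).IsLinear k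
  ψ : ∀ {ε₂ ε₁ ε : Parity} {ω₂ ω₁ ω : Γ} (h₂ : π ω₂ = ε₂.sign) (h₁ : π ω₁ = ε₁.sign)
    (h : π ω = ε.sign), ω₂ * ω₁ = ω → ∀ x : V, (act h₂).obj ((act h₁).obj x) ≅ (act h).obj x
  ψe : (act (sign_one π)).cov ≅ 𝟭 V
  /-- naturality of `ψ_{ω₂,ω₁}` for `π(ω₂) = 1`, `π(ω₁) = 1` -/
  nat_even_even : ∀ {ω₂ ω₁ ω : Γ} (h₂ : π ω₂ = Parity.even.sign) (h₁ : π ω₁ = Parity.even.sign)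
    (h : π ω = Parity.even.sign) (m : ω₂ * ω₁ = ω) {x y : V} (f : x ⟶ y),
    (act h₂).cov.map ((act h₁).cov.map f) ≫ (ψ h₂ h₁ h m y).hom =
      (ψ h₂ h₁ h m x).hom ≫ (act h).cov.map f
  /-- naturality of `ψ_{ω₂,ω₁}` for `π(ω₂) = 1`, `π(ω₁) = -1` -/
  nat_even_odd : ∀ {ω₂ ω₁ ω : Γ} (h₂ : π ω₂ = Parity.even.sign) (h₁ : π ω₁ = Parity.odd.sign)
    (h : π ω = Parity.odd.sign) (m : ω₂ * ω₁ = ω) {x y : V} (f : x ⟶ y),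
    (act h₂).cov.map ((act h₁).contra.map f.op) ≫ (ψ h₂ h₁ h m x).hom =
      (ψ h₂ h₁ h m y).hom ≫ (act h).contra.map f.op
  /-- naturality of `ψ_{ω₂,ω₁}` for `π(ω₂) = -1`, `π(ω₁) = 1` -/
  nat_odd_even : ∀ {ω₂ ω₁ ω : Γ} (h₂ : π ω₂ = Parity.odd.sign) (h₁ : π ω₁ = Parity.even.sign)
    (h : π ω = Parity.odd.sign) (m : ω₂ * ω₁ = ω) {x y : V} (f : x ⟶ y),
    (act h₂).contra.map ((act h₁).cov.map f).op ≫ (ψ h₂ h₁ h m x).hom =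
      (ψ h₂ h₁ h m y).hom ≫ (act h).contra.map f.op
  /-- naturality of `ψ_{ω₂,ω₁}` for `π(ω₂) = -1`, `π(ω₁) = -1` -/
  nat_odd_odd : ∀ {ω₂ ω₁ ω : Γ} (h₂ : π ω₂ = Parity.odd.sign) (h₁ : π ω₁ = Parity.odd.sign)
    (h : π ω = Parity.even.sign) (m : ω₂ * ω₁ = ω) {x y : V} (f : x ⟶ y),
    (act h₂).contra.map ((act h₁).contra.map f.op).op ≫ (ψ h₂ h₁ h m y).hom =
      (ψ h₂ h₁ h m x).hom ≫ (act h).cov.map f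
  /-- `α([ω₃|ω₂|ω₁]) ψ_{ω₃ω₂,ω₁} ∘ (ψ_{ω₃,ω₂} ρ(ω₁)) = ψ_{ω₃,ω₂ω₁} ∘ ρ(ω₃)(ψ_{ω₂,ω₁}^{π(ω₃)})` -/
  assoc : ∀ {ε₃ ε₂ ε₁ ε₃₂ ε₂₁ ε : Parity} {ω₃ ω₂ ω₁ ω₃₂ ω₂₁ ω : Γ}
    (h₃ : π ω₃ = ε₃.sign) (h₂ : π ω₂ = ε₂.sign) (h₁ : π ω₁ = ε₁.sign)
    (h₃₂ : π ω₃₂ = ε₃₂.sign) (h₂₁ : π ω₂₁ = ε₂₁.sign) (h : π ω = ε.sign)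
    (m₃₂ : ω₃ * ω₂ = ω₃₂) (m₂₁ : ω₂ * ω₁ = ω₂₁) (m : ω₃₂ * ω₁ = ω) (m' : ω₃ * ω₂₁ = ω) (x : V),
    (α ω₃ ω₂ ω₁ : k) •
        ((ψ h₃ h₂ h₃₂ m₃₂ ((act h₁).obj x)).hom ≫ (ψ h₃₂ h₁ h m x).hom) =
      ((act h₃).mapIso (ψ h₂ h₁ h₂₁ m₂₁ x)).hom ≫ (ψ h₃ h₂₁ h m' x).hom
  /-- `ψ_{1,ω} = ψe ρ(ω)` -/
  unit_left : ∀ {ε : Parity} {ω : Γ} (h : π ω = ε.sign) (x : V),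
    ψ (sign_one π) h h (one_mul ω) x = ψe.app ((act h).obj x)
  /-- `ψ_{ω,1} = ρ(ω)(ψe ^ π(ω))` -/
  unit_right : ∀ {ε : Parity} {ω : Γ} (h : π ω = ε.sign) (x : V),
    ψ h (sign_one π) h (mul_one ω) x = (act h).mapIso (ψe.app x)

namespace TwistedRep

section Ungraded

variable {k : Type*} [Field k] {Γ : Type*} [Group Γ] {α : TwistedCocycle k (1 : Γ →* ℤˣ)}
  {V : Type u} [Category.{v} V] [Preadditive V] [Linear k V]

/-- The functor `ρ(g)` of an ungraded representation. -/
def fn (ρ : TwistedRep 1 α V) (g : Γ) : V ⥤ V := (ρ.act (ε := .even) (ω := g) rfl).cov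

/-- The isomorphism `ψ_{g₂,g₁}` of an ungraded representation. -/
def mulIso (ρ : TwistedRep 1 α V) {g₂ g₁ g : Γ} (m : g₂ * g₁ = g) (x : V) :
    (ρ.fn g₂).obj ((ρ.fn g₁).obj x) ≅ (ρ.fn g).obj x :=
  ρ.ψ (ε₂ := .even) (ε₁ := .even) (ε := .even) rfl rfl rfl m x

/-- The isomorphism `ψe` of an ungraded representation. -/
def oneIso (ρ : TwistedRep 1 α V) : ρ.fn 1 ≅ 𝟭 V := ρ.ψe

instance (ρ : TwistedRep 1 α V) (g : Γ) : (ρ.fn g).Additive :=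
  (ρ.linear (ε := .even) (ω := g) rfl).1

instance (ρ : TwistedRep 1 α V) (g : Γ) : (ρ.fn g).Linear k :=
  (ρ.linear (ε := .even) (ω := g) rfl).2

lemma mulIso_nat (ρ : TwistedRep 1 α V) {g₂ g₁ g : Γ} (m : g₂ * g₁ = g) {x y : V} (f : x ⟶ y) :
    (ρ.fn g₂).map ((ρ.fn g₁).map f) ≫ (ρ.mulIso m y).hom =
      (ρ.mulIso m x).hom ≫ (ρ.fn g).map f :=
  ρ.nat_even_even rfl rfl rfl m f

lemma mulIso_inv_nat (ρ : TwistedRep 1 α V) {g₂ g₁ g : Γ} (m : g₂ * g₁ = g) {x y : V}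
    (f : x ⟶ y) :
    (ρ.mulIso m x).inv ≫ (ρ.fn g₂).map ((ρ.fn g₁).map f) =
      (ρ.fn g).map f ≫ (ρ.mulIso m y).inv := by
  rw [Iso.inv_comp_eq, ← Category.assoc, Iso.eq_comp_inv, mulIso_nat]

lemma mulIso_assoc (ρ : TwistedRep 1 α V) {g₃ g₂ g₁ g₃₂ g₂₁ g : Γ} (m₃₂ : g₃ * g₂ = g₃₂)
    (m₂₁ : g₂ * g₁ = g₂₁) (m : g₃₂ * g₁ = g) (m' : g₃ * g₂₁ = g) (x : V) :
    (α g₃ g₂ g₁ : k) • ((ρ.mulIso m₃₂ ((ρ.fn g₁).obj x)).hom ≫ (ρ.mulIso m x).hom) =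
      (ρ.fn g₃).map (ρ.mulIso m₂₁ x).hom ≫ (ρ.mulIso m' x).hom :=
  ρ.assoc (ε₃ := .even) (ε₂ := .even) (ε₁ := .even) (ε₃₂ := .even) (ε₂₁ := .even) (ε := .even)
    rfl rfl rfl rfl rfl rfl m₃₂ m₂₁ m m' x

lemma mulIso_assoc_scaled (ρ : TwistedRep 1 α V) {g₃ g₂ g₁ g₃₂ g₂₁ g : Γ} (m₃₂ : g₃ * g₂ = g₃₂)
    (m₂₁ : g₂ * g₁ = g₂₁) (m : g₃₂ * g₁ = g) (m' : g₃ * g₂₁ = g) (x : V) {a c₁ c₂ c₃ c₄ : kˣ}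
    (hc : a * c₁ * c₂ = α g₃ g₂ g₁ * c₃ * c₄) :
    (a : k) • ((scaleIso c₁ (ρ.mulIso m₃₂ ((ρ.fn g₁).obj x))).hom ≫
        (scaleIso c₂ (ρ.mulIso m x)).hom) =
      (ρ.fn g₃).map (scaleIso c₃ (ρ.mulIso m₂₁ x)).hom ≫ (scaleIso c₄ (ρ.mulIso m' x)).hom := by
  have hc' := congrArg (Units.val) hc
  push_cast at hc'
  simp only [scaleIso_hom, Functor.map_smul,
    Linear.smul_comp, Linear.comp_smul, ← mulIso_assoc ρ m₃₂ m₂₁ m m' x, smul_smul]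
  congr 1
  linear_combination hc'

lemma mulIso_assoc_scaled_inv (ρ : TwistedRep 1 α V) {g₃ g₂ g₁ g₃₂ g₂₁ g : Γ}
    (m₃₂ : g₃ * g₂ = g₃₂) (m₂₁ : g₂ * g₁ = g₂₁) (m : g₃₂ * g₁ = g) (m' : g₃ * g₂₁ = g) (x : V)
    {a c₁ c₂ c₃ c₄ : kˣ} (hc : a⁻¹ * c₁ * c₂ = α g₃ g₂ g₁ * c₃ * c₄) :
    (a : k) • ((scaleIso c₂ (ρ.mulIso m x)).inv ≫
        (scaleIso c₁ (ρ.mulIso m₃₂ ((ρ.fn g₁).obj x))).inv) =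
      (scaleIso c₄ (ρ.mulIso m' x)).inv ≫ (ρ.fn g₃).map (scaleIso c₃ (ρ.mulIso m₂₁ x)).inv := by
  have h : scaleIso a⁻¹ (scaleIso c₁ (ρ.mulIso m₃₂ ((ρ.fn g₁).obj x)) ≪≫
      scaleIso c₂ (ρ.mulIso m x)) =
      (ρ.fn g₃).mapIso (scaleIso c₃ (ρ.mulIso m₂₁ x)) ≪≫ scaleIso c₄ (ρ.mulIso m' x) :=
    Iso.ext (ρ.mulIso_assoc_scaled m₃₂ m₂₁ m m' x hc)
  simpa using congrArg Iso.inv h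

lemma oneIso_left (ρ : TwistedRep 1 α V) (g : Γ) (x : V) :
    ρ.mulIso (one_mul g) x = ρ.oneIso.app ((ρ.fn g).obj x) :=
  ρ.unit_left (ε := .even) (ω := g) rfl x

lemma oneIso_right (ρ : TwistedRep 1 α V) (g : Γ) (x : V) :
    ρ.mulIso (mul_one g) x = (ρ.fn g).mapIso (ρ.oneIso.app x) :=
  ρ.unit_right (ε := .even) (ω := g) rfl x

/-- The isomorphism `ψe` for an element `g` with a proof of `g = 1`. -/
def oneIsoOf (ρ : TwistedRep 1 α V) {g : Γ} (hg : g = 1) (x : V) : (ρ.fn g).obj x ≅ x :=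
  eqToIso (by rw [hg]) ≪≫ ρ.oneIso.app x

lemma oneIsoOf_nat (ρ : TwistedRep 1 α V) {g : Γ} (hg : g = 1) {x y : V} (f : x ⟶ y) :
    (ρ.fn g).map f ≫ (ρ.oneIsoOf hg y).hom = (ρ.oneIsoOf hg x).hom ≫ f := by
  subst hg
  simp [oneIsoOf]

lemma oneIsoOf_inv_nat (ρ : TwistedRep 1 α V) {g : Γ} (hg : g = 1) {x y : V} (f : x ⟶ y) :
    f ≫ (ρ.oneIsoOf hg y).inv = (ρ.oneIsoOf hg x).inv ≫ (ρ.fn g).map f := by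
  subst hg
  simpa [oneIsoOf] using ρ.oneIso.inv.naturality f

lemma mulIso_one_left (ρ : TwistedRep 1 α V) {g₂ g : Γ} (hg : g₂ = 1) (m : g₂ * g = g) {c : kˣ}
    (hc : c = 1) (x : V) :
    scaleIso c (ρ.mulIso m x) = ρ.oneIsoOf hg ((ρ.fn g).obj x) := by
  subst hg hc
  have := ρ.oneIso_left g x
  ext
  simp [oneIsoOf, this]

lemma mulIso_one_right (ρ : TwistedRep 1 α V) {g₁ g : Γ} (hg : g₁ = 1) (m : g * g₁ = g) {c : kˣ}
    (hc : c = 1) (x : V) :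
    scaleIso c (ρ.mulIso m x) = (ρ.fn g).mapIso (ρ.oneIsoOf hg x) := by
  subst hg hc
  have := ρ.oneIso_right g x
  ext
  simp [oneIsoOf, this]

lemma scale_mulIso_nat (ρ : TwistedRep 1 α V) {g₂ g₁ g : Γ} (m : g₂ * g₁ = g) (c : kˣ) {x y : V}
    (f : x ⟶ y) :
    (ρ.fn g₂).map ((ρ.fn g₁).map f) ≫ (scaleIso c (ρ.mulIso m y)).hom =
      (scaleIso c (ρ.mulIso m x)).hom ≫ (ρ.fn g).map f := by
  simp [mulIso_nat]

lemma scale_mulIso_inv_nat (ρ : TwistedRep 1 α V) {g₂ g₁ g : Γ} (m : g₂ * g₁ = g) (c : kˣ)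
    {x y : V} (f : x ⟶ y) :
    (scaleIso c (ρ.mulIso m x)).inv ≫ (ρ.fn g₂).map ((ρ.fn g₁).map f) =
      (ρ.fn g).map f ≫ (scaleIso c (ρ.mulIso m y)).inv := by
  simp [mulIso_inv_nat]

lemma not_odd {g : Γ} (h : (1 : Γ →* ℤˣ) g = Parity.odd.sign) : False :=
  absurd (show (1 : ℤˣ) = -1 from h) (by decide)

/-- A representation of an ungraded group is determined by its data in degree `1`. -/
def ofUngraded (F : Γ → V ⥤ V) (hF : ∀ g, (F g).Additive ∧ (F g).Linear k)
    (ψ : ∀ {g₂ g₁ g : Γ}, g₂ * g₁ = g → ∀ x : V, (F g₂).obj ((F g₁).obj x) ≅ (F g).obj x)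
    (ψe : F 1 ≅ 𝟭 V)
    (nat : ∀ {g₂ g₁ g : Γ} (m : g₂ * g₁ = g) {x y : V} (f : x ⟶ y),
      (F g₂).map ((F g₁).map f) ≫ (ψ m y).hom = (ψ m x).hom ≫ (F g).map f)
    (assoc : ∀ {g₃ g₂ g₁ g₃₂ g₂₁ g : Γ} (m₃₂ : g₃ * g₂ = g₃₂) (m₂₁ : g₂ * g₁ = g₂₁)
      (m : g₃₂ * g₁ = g) (m' : g₃ * g₂₁ = g) (x : V),
      (α g₃ g₂ g₁ : k) • ((ψ m₃₂ ((F g₁).obj x)).hom ≫ (ψ m x).hom) =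
        (F g₃).map (ψ m₂₁ x).hom ≫ (ψ m' x).hom)
    (unit_left : ∀ (g : Γ) (x : V), ψ (one_mul g) x = ψe.app ((F g).obj x))
    (unit_right : ∀ (g : Γ) (x : V), ψ (mul_one g) x = (F g).mapIso (ψe.app x)) :
    TwistedRep 1 α V where
  act {ε ω} h :=
    match ε, h with
    | .even, _ => F ω
    | .odd, h => (not_odd h).elim
  linear {ε ω} h :=
    match ε, h with
    | .even, _ => hF ω
    | .odd, h => (not_odd h).elim
  ψ {ε₂ ε₁ ε _ _ _} h₂ h₁ h m x :=
    match ε₂, ε₁, ε, h₂, h₁, h with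
    | .even, .even, .even, _, _, _ => ψ m x
    | .odd, _, _, h, _, _ => (not_odd h).elim
    | _, .odd, _, _, h, _ => (not_odd h).elim
    | _, _, .odd, _, _, h => (not_odd h).elim
  ψe := ψe
  nat_even_even _ _ _ m _ _ f := nat m f
  nat_even_odd _ h := (not_odd h).elim
  nat_odd_even h := (not_odd h).elim
  nat_odd_odd h := (not_odd h).elim
  assoc {ε₃ ε₂ ε₁ ε₃₂ ε₂₁ ε _ _ _ _ _ _} h₃ h₂ h₁ h₃₂ h₂₁ h m₃₂ m₂₁ m m' x := by
    cases ε₃ <;> [skip; exact (not_odd h₃).elim]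
    cases ε₂ <;> [skip; exact (not_odd h₂).elim]
    cases ε₁ <;> [skip; exact (not_odd h₁).elim]
    cases ε₃₂ <;> [skip; exact (not_odd h₃₂).elim]
    cases ε₂₁ <;> [skip; exact (not_odd h₂₁).elim]
    cases ε <;> [skip; exact (not_odd h).elim]
    exact assoc m₃₂ m₂₁ m m' x
  unit_left {ε ω} h x := by
    cases ε <;> [skip; exact (not_odd h).elim]
    exact unit_left ω x
  unit_right {ε ω} h x := by
    cases ε <;> [skip; exact (not_odd h).elim]
    exact unit_right ω x

end Ungraded

end TwistedRep

/-! ### Induction from `H` to the ungraded group `G = ker π` -/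

section Induction

variable {k : Type*} [Field k] {Γ : Type*} [Group Γ] {π : Γ →* ℤˣ}

/-- A complete set of representatives of the left cosets of `H` in `G = ker π`. -/
structure CosetReps (π : Γ →* ℤˣ) (H : Subgroup Γ) (ι : Type*) where
  rep : ι → π.ker
  existsUnique : ∀ g : π.ker, ∃! i, (rep i : Γ)⁻¹ * g ∈ H

namespace CosetReps

variable {H : Subgroup Γ} {ι : Type*} (R : CosetReps π H ι)

lemma exists_idx (g : π.ker) (j : ι) : ∃ i, (R.rep j : Γ)⁻¹ * g * R.rep i ∈ H := by
  obtain ⟨i, hi, -⟩ := R.existsUnique (g⁻¹ * R.rep j)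
  refine ⟨i, ?_⟩
  have := H.inv_mem hi
  simpa [mul_assoc] using this

/-- The index `i` with `g rᵢ ∈ rⱼ H`. -/
noncomputable def idx (g : π.ker) (j : ι) : ι := (R.exists_idx g j).choose

/-- The element `h ∈ H` with `g rᵢ = rⱼ h`, where `i = idx g j`. -/
noncomputable def coef (g : π.ker) (j : ι) : H :=
  ⟨(R.rep j : Γ)⁻¹ * g * R.rep (R.idx g j), (R.exists_idx g j).choose_spec⟩

lemma rep_mul_coef (g : π.ker) (j : ι) :
    (g : Γ) * R.rep (R.idx g j) = R.rep j * R.coef g j := by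
  simp [coef, mul_assoc]

lemma idx_unique {g : π.ker} {j i : ι} (h : (R.rep j : Γ)⁻¹ * g * R.rep i ∈ H) :
    R.idx g j = i := by
  refine (R.existsUnique (g⁻¹ * R.rep j)).unique ?_ ?_
  · have := H.inv_mem (show (R.rep j : Γ)⁻¹ * g * R.rep (R.idx g j) ∈ H from (R.coef g j).2)
    simpa [mul_assoc] using this
  · simpa [mul_assoc] using H.inv_mem h

lemma idx_mul {g₂ g₁ g : π.ker} (m : g₂ * g₁ = g) (j : ι) :
    R.idx g₁ (R.idx g₂ j) = R.idx g j := by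
  subst m
  refine (R.idx_unique ?_).symm
  have := H.mul_mem (R.coef g₂ j).2 (R.coef g₁ (R.idx g₂ j)).2
  simpa [coef, mul_assoc] using this

lemma coef_mul {g₂ g₁ g : π.ker} (m : g₂ * g₁ = g) (j : ι) :
    R.coef g₂ j * R.coef g₁ (R.idx g₂ j) = R.coef g j := by
  apply Subtype.ext
  simp only [coef, Subgroup.coe_mul, ← R.idx_mul m]
  simp [← m, mul_assoc]

lemma idx_one (j : ι) : R.idx 1 j = j := R.idx_unique (by simp)

lemma coef_one (j : ι) : R.coef 1 j = 1 := by
  apply Subtype.ext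
  simp [coef, R.idx_one]

end CosetReps

namespace TwistedRep

variable {α : TwistedCocycle k π} {H : Subgroup Γ} {hH : H ≤ π.ker} {ι : Type*}
  {V : Type u} [Category.{v} V] [Preadditive V] [Linear k V]

/-- The functor `Ind(ρ)(g)` on `∏_{G/H} V`, with `(Ind(ρ)(g) x)_j = ρ(h)(xᵢ)` for
`g rᵢ = rⱼ h`. -/
noncomputable def indFun (ρ : TwistedRep 1 (α.res hH) V) (R : CosetReps π H ι) (g : π.ker) :
    (ι → V) ⥤ (ι → V) where
  obj x j := (ρ.fn (R.coef g j)).obj (x (R.idx g j))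
  map f j := (ρ.fn (R.coef g j)).map (f (R.idx g j))
  map_id _ := funext fun _ => (ρ.fn _).map_id _
  map_comp _ _ := funext fun _ => (ρ.fn _).map_comp _ _

/-- The isomorphism `ψ_{h₂,h₁}` at `xᵢ`, followed by the identification of `xᵢ` and `xᵢ'` for
equal indices `i` and `i'`. -/
def mulIsoIdx (ρ : TwistedRep 1 (α.res hH) V) {h₂ h₁ h : H} (m : h₂ * h₁ = h) (x : ι → V)
    {i i' : ι} (e : i = i') : (ρ.fn h₂).obj ((ρ.fn h₁).obj (x i)) ≅ (ρ.fn h).obj (x i') :=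
  ρ.mulIso m (x i) ≪≫ (ρ.fn h).mapIso (eqToIso (congrArg x e))

/-- The scalar `α([g₂|rⱼ|h₁]) / (α([g₂|g₁|rᵢ]) α([r_l|h₂|h₁]))`, where `g₁ rᵢ = rⱼ h₁` and
`g₂ rⱼ = r_l h₂`. -/
noncomputable def indCoeff (α : TwistedCocycle k π) (R : CosetReps π H ι) (g₂ g₁ : π.ker)
    (l : ι) : kˣ :=
  α.coeff g₂ g₁ (R.rep l) (R.rep (R.idx g₂ l)) (R.rep (R.idx g₁ (R.idx g₂ l)))
    (R.coef g₂ l) (R.coef g₁ (R.idx g₂ l))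

/-- The isomorphism `Ind(ψ)_{g₂,g₁}`. For `g₁ rᵢ = rⱼ h₁` and `g₂ rⱼ = r_l h₂`, the component at
the coset of `r_l` is
`α([g₂|rⱼ|h₁]) / (α([g₂|g₁|rᵢ]) α([r_l|h₂|h₁])) ψ_{h₂,h₁}`. -/
noncomputable def indMul (ρ : TwistedRep 1 (α.res hH) V) (R : CosetReps π H ι) {g₂ g₁ g : π.ker}
    (m : g₂ * g₁ = g) (x : ι → V) :
    (ρ.indFun R g₂).obj ((ρ.indFun R g₁).obj x) ≅ (ρ.indFun R g).obj x :=
  Pi.isoMk fun l =>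
    scaleIso (indCoeff α R g₂ g₁ l) (ρ.mulIsoIdx (R.coef_mul m l) x (R.idx_mul m l))

lemma indCoeff_assoc (α : TwistedCocycle k π) (hH : H ≤ π.ker) (R : CosetReps π H ι)
    (g₃ g₂ g₁ : π.ker) (l : ι) :
    α g₃ g₂ g₁ * indCoeff α R g₃ g₂ l * indCoeff α R (g₃ * g₂) g₁ l =
      (α.res hH) (R.coef g₃ l) (R.coef g₂ (R.idx g₃ l)) (R.coef g₁ (R.idx g₂ (R.idx g₃ l))) *
        indCoeff α R g₂ g₁ (R.idx g₃ l) * indCoeff α R g₃ (g₂ * g₁) l := by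
  have h := α.coeff_assoc (R.rep_mul_coef g₁ (R.idx g₂ (R.idx g₃ l)))
    (R.rep_mul_coef g₂ (R.idx g₃ l)) (R.rep_mul_coef g₃ l)
  rw [show π (R.rep l) = 1 from (R.rep l).2, show π g₃ = 1 from g₃.2] at h
  simpa only [indCoeff, ← R.coef_mul (rfl : g₃ * g₂ = g₃ * g₂),
    ← R.idx_mul (rfl : g₃ * g₂ = g₃ * g₂), ← R.coef_mul (rfl : g₂ * g₁ = g₂ * g₁),
    ← R.idx_mul (rfl : g₂ * g₁ = g₂ * g₁), Units.val_one, zpow_one,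
    Subgroup.coe_mul, TwistedCocycle.res_toFun] using h

/-- The isomorphism `ψe` at `xᵢ`, with the identification of `xᵢ` and `xᵢ'` for equal indices
`i` and `i'`. -/
def oneIsoIdx (ρ : TwistedRep 1 (α.res hH) V) {h : H} (hh : h = 1) (x : ι → V) {i i' : ι}
    (e : i = i') : (ρ.fn h).obj (x i) ≅ x i' :=
  eqToIso (by rw [hh]) ≪≫ ρ.oneIso.app (x i) ≪≫ eqToIso (congrArg x e)

lemma mulIsoIdx_nat (ρ : TwistedRep 1 (α.res hH) V) {h₂ h₁ h : H} (m : h₂ * h₁ = h) {x y : ι → V}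
    (f : x ⟶ y) {i i' : ι} (e : i = i') :
    (ρ.fn h₂).map ((ρ.fn h₁).map (f i)) ≫ (ρ.mulIsoIdx m y e).hom =
      (ρ.mulIsoIdx m x e).hom ≫ (ρ.fn h).map (f i') := by
  subst e
  simp [mulIsoIdx, mulIso_nat]

lemma mulIsoIdx_assoc (ρ : TwistedRep 1 (α.res hH) V) (c : ι → H) (d : ι → ι)
    {j j' i i' : ι} {h₃ h₂ h₃₂ h₂₁ h : H} (m₃₂ : h₃ * h₂ = h₃₂) (m₂₁ : h₂ * c j = h₂₁)
    (m : h₃₂ * c j' = h) (m' : h₃ * h₂₁ = h) (x : ι → V) (ej : j = j') (e₁ : d j = i)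
    (e₂ : d j' = i') (e₃ : i = i') :
    (α h₃ h₂ (c j) : k) •
        ((ρ.mulIsoIdx m₃₂ (fun j => (ρ.fn (c j)).obj (x (d j))) ej).hom ≫
          (ρ.mulIsoIdx m x e₂).hom) =
      (ρ.fn h₃).map (ρ.mulIsoIdx m₂₁ x e₁).hom ≫ (ρ.mulIsoIdx m' x e₃).hom := by
  subst ej e₁ e₃
  simpa [mulIsoIdx] using ρ.mulIso_assoc m₃₂ m₂₁ m m' (x (d j))

lemma oneIsoIdx_nat (ρ : TwistedRep 1 (α.res hH) V) {h : H} (hh : h = 1) {x y : ι → V}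
    (f : x ⟶ y) {i i' : ι} (e : i = i') :
    (ρ.fn h).map (f i) ≫ (ρ.oneIsoIdx hh y e).hom = (ρ.oneIsoIdx hh x e).hom ≫ f i' := by
  subst hh e
  simp [oneIsoIdx]

lemma mulIsoIdx_one_left (ρ : TwistedRep 1 (α.res hH) V) (c : ι → H) (d : ι → ι) {j j' : ι}
    {h : H} (hh : h = 1) (m : h * c j = c j') (x : ι → V) (e : j = j') (e₁ : d j = d j') :
    ρ.mulIsoIdx m x e₁ = ρ.oneIsoIdx hh (fun j => (ρ.fn (c j)).obj (x (d j))) e := by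
  subst hh e
  have := ρ.oneIso_left (c j) (x (d j))
  ext
  simp [mulIsoIdx, oneIsoIdx, this]

lemma mulIsoIdx_one_right (ρ : TwistedRep 1 (α.res hH) V) {g h : H} (hh : h = 1)
    (m : g * h = g) (x : ι → V) {i i' : ι} (e : i = i') :
    ρ.mulIsoIdx m x e = (ρ.fn g).mapIso (ρ.oneIsoIdx hh x e) := by
  subst hh e
  have := ρ.oneIso_right g (x i)
  ext
  simp [mulIsoIdx, oneIsoIdx, this]

/-- The induced representation `Ind_H^G(ρ)` of `G = ker π` on `∏_{G/H} V`. -/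
noncomputable def ind (ρ : TwistedRep 1 (α.res hH) V) (R : CosetReps π H ι) :
    TwistedRep (1 : π.ker →* ℤˣ) (α.res le_rfl) (ι → V) :=
  ofUngraded (ρ.indFun R)
    (fun g => ⟨⟨fun {_ _ _ _} => funext fun _ => (ρ.fn _).map_add⟩,
      ⟨fun _ _ => funext fun _ => (ρ.fn _).map_smul _ _⟩⟩)
    (ρ.indMul R)
    (NatIso.ofComponents
      (fun x => Pi.isoMk fun l => ρ.oneIsoIdx (R.coef_one l) x (R.idx_one l))
      (fun f => funext fun l => ρ.oneIsoIdx_nat (R.coef_one l) f (R.idx_one l)))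
    (fun m x y f => funext fun l => by
      have := ρ.mulIsoIdx_nat (R.coef_mul m l) f (R.idx_mul m l)
      simp only [indMul, indFun, Pi.comp_apply, Pi.isoMk_hom, scaleIso_hom, Linear.comp_smul,
        Linear.smul_comp, this])
    (fun {g₃ g₂ g₁ g₃₂ g₂₁ g} m₃₂ m₂₁ m m' x => funext fun l => by
      have h₁ := ρ.mulIsoIdx_assoc (R.coef g₁) (R.idx g₁) (R.coef_mul m₃₂ l)
        (R.coef_mul m₂₁ (R.idx g₃ l)) (R.coef_mul m l) (R.coef_mul m' l) x (R.idx_mul m₃₂ l)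
        (R.idx_mul m₂₁ (R.idx g₃ l)) (R.idx_mul m l) (R.idx_mul m' l)
      have h₂ := congrArg Units.val (indCoeff_assoc α hH R g₃ g₂ g₁ l)
      subst m₃₂ m₂₁
      push_cast at h₂
      refine (pi_smul_apply _ _ _).trans ?_
      simp only [Pi.comp_apply, indMul, indFun, Pi.isoMk_hom, scaleIso_hom, Linear.comp_smul,
        Linear.smul_comp, Functor.map_smul, ← h₁, smul_smul, TwistedCocycle.res_toFun] at h₂ ⊢
      refine (smul_smul _ _ _).trans ?_
      congr 1
      linear_combination h₂)
    (fun g x => Iso.ext <| funext fun l => by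
      have := ρ.mulIsoIdx_one_left (R.coef g) (R.idx g) (R.coef_one l) (R.coef_mul (one_mul g) l) x
        (R.idx_one l) (R.idx_mul (one_mul g) l)
      simp [indMul, this, indFun, indCoeff, TwistedCocycle.coeff, R.coef_one])
    (fun g x => Iso.ext <| funext fun l => by
      have := ρ.mulIsoIdx_one_right (R.coef_one (R.idx g l)) (R.coef_mul (mul_one g) l) x
        (R.idx_mul (mul_one g) l)
      simp [indMul, this, indFun, indCoeff, TwistedCocycle.coeff, R.coef_one])

end TwistedRep

end Induction

/-! ### Hyperbolic induction from the ungraded group `G = ker π` -/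

section Hyperbolic

variable {k : Type*} [Field k] {Γ : Type*} [Group Γ] {π : Γ →* ℤˣ} {ς : Γ}

/-- `g`, for `g` of degree `1`, as an element of `G`. -/
def evenElt {ω : Γ} (h : π ω = Parity.even.sign) : π.ker := ⟨ω, h⟩

/-- `ς⁻¹ g ς`, for `g` of degree `1`, as an element of `G`. -/
def conjElt (hς : π ς = -1) {ω : Γ} (h : π ω = Parity.even.sign) : π.ker :=
  ⟨ς⁻¹ * ω * ς, by
    have h' : π ω = 1 := h
    simp [MonoidHom.mem_ker, hς, h']⟩

lemma conjElt_one (hς : π ς = -1) : conjElt hς (sign_one π) = 1 :=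
  Subtype.ext (by simp [conjElt])

/-- `ω ς`, for `ω` of degree `-1`, as an element of `G`. -/
def mulElt (hς : π ς = -1) {ω : Γ} (h : π ω = Parity.odd.sign) : π.ker :=
  ⟨ω * ς, by
    have h' : π ω = -1 := h
    simp [MonoidHom.mem_ker, hς, h']⟩

/-- `ς⁻¹ ω`, for `ω` of degree `-1`, as an element of `G`. -/
def invMulElt (hς : π ς = -1) {ω : Γ} (h : π ω = Parity.odd.sign) : π.ker :=
  ⟨ς⁻¹ * ω, by
    have h' : π ω = -1 := h
    simp [MonoidHom.mem_ker, hς, h']⟩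

namespace TwistedCocycle

/-- The associativity of the scalars `coeff` for `ηᵢ = sᵢ⁻¹ ωᵢ sᵢ₋₁`. -/
lemma hyp_coeff (α : TwistedCocycle k π) (ω₃ ω₂ ω₁ s₃ s₂ s₁ s₀ : Γ) :
    α ω₃ ω₂ ω₁ * α.coeff ω₃ ω₂ s₃ s₂ s₁ (s₃⁻¹ * (ω₃ * s₂)) (s₂⁻¹ * (ω₂ * s₁)) *
        α.coeff (ω₃ * ω₂) ω₁ s₃ s₁ s₀ (s₃⁻¹ * (ω₃ * (ω₂ * s₁))) (s₁⁻¹ * (ω₁ * s₀)) =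
      α (s₃⁻¹ * (ω₃ * s₂)) (s₂⁻¹ * (ω₂ * s₁)) (s₁⁻¹ * (ω₁ * s₀)) ^ ((π s₃ : ℤˣ) : ℤ) *
        α.coeff ω₂ ω₁ s₂ s₁ s₀ (s₂⁻¹ * (ω₂ * s₁)) (s₁⁻¹ * (ω₁ * s₀)) ^ ((π ω₃ : ℤˣ) : ℤ) *
        α.coeff ω₃ (ω₂ * ω₁) s₃ s₂ s₀ (s₃⁻¹ * (ω₃ * s₂)) (s₂⁻¹ * (ω₂ * (ω₁ * s₀))) := by
  have h := α.coeff_assoc (show ω₁ * s₀ = s₁ * (s₁⁻¹ * (ω₁ * s₀)) by simp)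
    (show ω₂ * s₁ = s₂ * (s₂⁻¹ * (ω₂ * s₁)) by simp)
    (show ω₃ * s₂ = s₃ * (s₃⁻¹ * (ω₃ * s₂)) by simp)
  simpa only [mul_assoc, mul_inv_cancel_left] using h

end TwistedCocycle

namespace TwistedRep

variable {α : TwistedCocycle k π} {W : Type u} [Category.{v} W] [Preadditive W] [Linear k W]

/-- The signed endofunctor of `W × Wᵒᵖ` by which `ω` acts on the hyperbolic representation:
`ρ(ω) × ρ(ς⁻¹ως)ᵒᵖ` for `π(ω) = 1`, and `(x, y) ↦ (ρ(ως) y, ρ(ς⁻¹ω)ᵒᵖ x)` for `π(ω) = -1`. -/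
def hypAct (ρ : TwistedRep (1 : π.ker →* ℤˣ) (α.res le_rfl) W) (hς : π ς = -1) :
    {ε : Parity} → {ω : Γ} → π ω = ε.sign → SignedEnd (W × Wᵒᵖ) ε
  | .even, _, h => show (W × Wᵒᵖ) ⥤ (W × Wᵒᵖ) from
      (ρ.fn (evenElt h)).prod (ρ.fn (conjElt hς h)).op
  | .odd, _, h => show (W × Wᵒᵖ)ᵒᵖ ⥤ (W × Wᵒᵖ) from
      { obj := fun X => ((ρ.fn (mulElt hς h)).obj X.unop.2.unop,
          op ((ρ.fn (invMulElt hς h)).obj X.unop.1))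
        map := fun f => Prod.mkHom ((ρ.fn (mulElt hς h)).map f.unop.2.unop)
          ((ρ.fn (invMulElt hς h)).map f.unop.1).op
        map_id := fun _ => Prod.ext ((ρ.fn _).map_id _)
          (Quiver.Hom.unop_inj ((ρ.fn _).map_id _))
        map_comp := fun _ _ => Prod.ext ((ρ.fn _).map_comp _ _)
          (Quiver.Hom.unop_inj ((ρ.fn _).map_comp _ _)) }

/-- An isomorphism in `W × Wᵒᵖ` from isomorphisms of the components in `W`; the second component
is `e₂⁻ᵒᵖ`. -/
def hypIso {x y : W} {x' y' : W} (e₁ : x ≅ y) (e₂ : x' ≅ y') :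
    ((x, op x') : W × Wᵒᵖ) ≅ (y, op y') :=
  Iso.prod e₁ e₂.symm.op

/-- The isomorphism `HInd(ψ)_{ω₂,ω₁}`. On the first factor it is a multiple of `ψ`, on the second
a multiple of `ψ⁻ᵒᵖ` (so that the scalar of `ψ` in `e₂` is the inverse of that of `ψ⁻ᵒᵖ`). -/
def hypMul (ρ : TwistedRep (1 : π.ker →* ℤˣ) (α.res le_rfl) W) (hς : π ς = -1) :
    {ε₂ ε₁ ε : Parity} → {ω₂ ω₁ ω : Γ} → (h₂ : π ω₂ = ε₂.sign) → (h₁ : π ω₁ = ε₁.sign) →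
      (h : π ω = ε.sign) → ω₂ * ω₁ = ω → (X : W × Wᵒᵖ) →
        ((ρ.hypAct hς h₂).obj ((ρ.hypAct hς h₁).obj X) ≅ (ρ.hypAct hς h).obj X)
  | .even, .even, .even, ω₂, ω₁, ω, h₂, h₁, h, m, X =>
      hypIso
        (scaleIso (1 : kˣ)
          (ρ.mulIso (Subtype.ext m : evenElt h₂ * evenElt h₁ = evenElt h) X.1))
        (scaleIso (α ω₂ ς (ς⁻¹ * ω₁ * ς) / (α ω₂ ω₁ ς * α ς (ς⁻¹ * ω₂ * ς) (ς⁻¹ * ω₁ * ς)))⁻¹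
          (ρ.mulIso (Subtype.ext (by simp [conjElt, ← m, mul_assoc]) :
            conjElt hς h₂ * conjElt hς h₁ = conjElt hς h) X.2.unop))
  | .odd, .even, .odd, ω₂, ω₁, ω, h₂, h₁, h, m, X =>
      hypIso
        (scaleIso (α ω₂ ς (ς⁻¹ * ω₁ * ς) / α ω₂ ω₁ ς)
          (ρ.mulIso (Subtype.ext (by simp [mulElt, conjElt, ← m, mul_assoc]) :
            mulElt hς h₂ * conjElt hς h₁ = mulElt hς h) X.2.unop))
        (scaleIso ((α ς (ς⁻¹ * ω₂) ω₁)⁻¹)⁻¹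
          (ρ.mulIso (Subtype.ext (by simp [invMulElt, evenElt, ← m, mul_assoc]) :
            invMulElt hς h₂ * evenElt h₁ = invMulElt hς h) X.1))
  | .even, .odd, .odd, ω₂, ω₁, ω, h₂, h₁, h, m, X =>
      hypIso
        (scaleIso (α ω₂ ω₁ ς)⁻¹
          (ρ.mulIso (Subtype.ext (by simp [evenElt, mulElt, ← m, mul_assoc]) :
            evenElt h₂ * mulElt hς h₁ = mulElt hς h) X.2.unop))
        (scaleIso (α ω₂ ς (ς⁻¹ * ω₁) / α ς (ς⁻¹ * ω₂ * ς) (ς⁻¹ * ω₁))⁻¹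
          (ρ.mulIso (Subtype.ext (by simp [conjElt, invMulElt, ← m, mul_assoc]) :
            conjElt hς h₂ * invMulElt hς h₁ = invMulElt hς h) X.1))
  | .odd, .odd, .even, ω₂, ω₁, ω, h₂, h₁, h, m, X =>
      hypIso
        (scaleIso (α ω₂ ς (ς⁻¹ * ω₁))
          (ρ.mulIso (Subtype.ext (by simp [mulElt, invMulElt, evenElt, ← m, mul_assoc]) :
            mulElt hς h₂ * invMulElt hς h₁ = evenElt h) X.1))
        (scaleIso ((α ω₂ ω₁ ς * α ς (ς⁻¹ * ω₂) (ω₁ * ς))⁻¹)⁻¹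
          (ρ.mulIso (Subtype.ext (by simp [invMulElt, mulElt, conjElt, ← m, mul_assoc]) :
            invMulElt hς h₂ * mulElt hς h₁ = conjElt hς h) X.2.unop))
  | .even, .even, .odd, _, _, _, h₂, h₁, h, m, _ => False.elim <| by
      rw [← m, map_mul, h₂, h₁] at h; exact absurd h (by decide)
  | .even, .odd, .even, _, _, _, h₂, h₁, h, m, _ => False.elim <| by
      rw [← m, map_mul, h₂, h₁] at h; exact absurd h (by decide)
  | .odd, .even, .even, _, _, _, h₂, h₁, h, m, _ => False.elim <| by
      rw [← m, map_mul, h₂, h₁] at h; exact absurd h (by decide)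
  | .odd, .odd, .odd, _, _, _, h₂, h₁, h, m, _ => False.elim <| by
      rw [← m, map_mul, h₂, h₁] at h; exact absurd h (by decide)

lemma parity_absurd {ω₂ ω₁ ω : Γ} {ε₂ ε₁ ε : Parity} (h₂ : π ω₂ = ε₂.sign) (h₁ : π ω₁ = ε₁.sign)
    (h : π ω = ε.sign) (m : ω₂ * ω₁ = ω) (hε : ε₂.sign * ε₁.sign ≠ ε.sign) : False := by
  rw [← m, map_mul, h₂, h₁] at h
  exact hε h

lemma hyp_assoc (ρ : TwistedRep (1 : π.ker →* ℤˣ) (α.res le_rfl) W) (hς : π ς = -1)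
    {ε₃ ε₂ ε₁ ε₃₂ ε₂₁ ε : Parity} {ω₃ ω₂ ω₁ ω₃₂ ω₂₁ ω : Γ}
    (h₃ : π ω₃ = ε₃.sign) (h₂ : π ω₂ = ε₂.sign) (h₁ : π ω₁ = ε₁.sign)
    (h₃₂ : π ω₃₂ = ε₃₂.sign) (h₂₁ : π ω₂₁ = ε₂₁.sign) (h : π ω = ε.sign)
    (m₃₂ : ω₃ * ω₂ = ω₃₂) (m₂₁ : ω₂ * ω₁ = ω₂₁) (m : ω₃₂ * ω₁ = ω) (m' : ω₃ * ω₂₁ = ω)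
    (X : W × Wᵒᵖ) :
    (α ω₃ ω₂ ω₁ : k) • ((ρ.hypMul hς h₃ h₂ h₃₂ m₃₂ ((ρ.hypAct hς h₁).obj X)).hom ≫
        (ρ.hypMul hς h₃₂ h₁ h m X).hom) =
      ((ρ.hypAct hς h₃).mapIso (ρ.hypMul hς h₂ h₁ h₂₁ m₂₁ X)).hom ≫
        (ρ.hypMul hς h₃ h₂₁ h m' X).hom := by
  cases ε₃ <;> cases ε₂ <;> cases ε₁ <;> cases ε₃₂ <;> cases ε₂₁ <;> cases ε <;>
    first
    | exact (parity_absurd h₃ h₂ h₃₂ m₃₂ (by decide)).elim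
    | exact (parity_absurd h₂ h₁ h₂₁ m₂₁ (by decide)).elim
    | exact (parity_absurd h₃ h₂₁ h m' (by decide)).elim
    | skip
  all_goals
    subst m₃₂ m₂₁
    refine Prod.ext (ρ.mulIso_assoc_scaled (a := α ω₃ ω₂ ω₁) _ _ _ _ _ ?_)
      (Quiver.Hom.unop_inj (ρ.mulIso_assoc_scaled_inv (a := α ω₃ ω₂ ω₁) _ _ _ _ _ ?_))
  all_goals simp only [evenElt, conjElt, mulElt, invMulElt, TwistedCocycle.res_toFun]
  on_goal 1 => have h := congrArg Additive.ofMul (α.hyp_coeff ω₃ ω₂ ω₁ ς ς ς ς)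
  on_goal 2 => have h := congrArg Additive.ofMul (α.hyp_coeff ω₃ ω₂ ω₁ 1 1 1 ς)
  on_goal 3 => have h := congrArg Additive.ofMul (α.hyp_coeff ω₃ ω₂ ω₁ ς ς ς 1)
  on_goal 4 => have h := congrArg Additive.ofMul (α.hyp_coeff ω₃ ω₂ ω₁ 1 1 ς ς)
  on_goal 5 => have h := congrArg Additive.ofMul (α.hyp_coeff ω₃ ω₂ ω₁ ς ς 1 1)
  on_goal 6 => have h := congrArg Additive.ofMul (α.hyp_coeff ω₃ ω₂ ω₁ 1 1 ς 1)
  on_goal 7 => have h := congrArg Additive.ofMul (α.hyp_coeff ω₃ ω₂ ω₁ ς ς 1 ς)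
  on_goal 8 => have h := congrArg Additive.ofMul (α.hyp_coeff ω₃ ω₂ ω₁ 1 ς ς ς)
  on_goal 9 => have h := congrArg Additive.ofMul (α.hyp_coeff ω₃ ω₂ ω₁ ς 1 1 1)
  on_goal 10 => have h := congrArg Additive.ofMul (α.hyp_coeff ω₃ ω₂ ω₁ 1 ς ς 1)
  on_goal 11 => have h := congrArg Additive.ofMul (α.hyp_coeff ω₃ ω₂ ω₁ ς 1 1 ς)
  on_goal 12 => have h := congrArg Additive.ofMul (α.hyp_coeff ω₃ ω₂ ω₁ 1 ς 1 1)
  on_goal 13 => have h := congrArg Additive.ofMul (α.hyp_coeff ω₃ ω₂ ω₁ ς 1 ς ς)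
  on_goal 14 => have h := congrArg Additive.ofMul (α.hyp_coeff ω₃ ω₂ ω₁ 1 ς 1 ς)
  on_goal 15 => have h := congrArg Additive.ofMul (α.hyp_coeff ω₃ ω₂ ω₁ ς 1 ς 1)
  all_goals
    apply Additive.ofMul.injective
    simp only [TwistedCocycle.coeff, h₃, hς, map_one, Parity.sign, ofMul_mul, ofMul_div, ofMul_zpow,
      ofMul_inv, mul_assoc, mul_one, one_mul, inv_one, Units.val_one, Units.val_neg,
      TwistedCocycle.one_left, TwistedCocycle.one_mid, TwistedCocycle.one_right, ofMul_one] at h ⊢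
    first
    | linear_combination (norm := module) h
    | linear_combination (norm := module) (-1 : ℤ) • h

/-- The hyperbolically induced representation `HInd_G^Γ(ρ)` on `W × Wᵒᵖ`, formed with an element
`ς` of degree `-1`. -/
def hInd (ρ : TwistedRep (1 : π.ker →* ℤˣ) (α.res le_rfl) W) (hς : π ς = -1) :
    TwistedRep π α (W × Wᵒᵖ) where
  act h := ρ.hypAct hς h
  linear {ε ω} h :=
    match ε, h with
    | .even, _ =>
      ⟨⟨fun {_ _ _ _} => Prod.ext ((ρ.fn _).map_add)
          (Quiver.Hom.unop_inj ((ρ.fn _).map_add))⟩,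
        ⟨fun _ _ => Prod.ext ((ρ.fn _).map_smul _ _)
          (Quiver.Hom.unop_inj ((ρ.fn _).map_smul _ _))⟩⟩
    | .odd, _ =>
      ⟨⟨fun {_ _ _ _} => Prod.ext ((ρ.fn _).map_add)
          (Quiver.Hom.unop_inj ((ρ.fn _).map_add))⟩,
        ⟨fun _ _ => Prod.ext ((ρ.fn _).map_smul _ _)
          (Quiver.Hom.unop_inj ((ρ.fn _).map_smul _ _))⟩⟩
  ψ h₂ h₁ h m X := ρ.hypMul hς h₂ h₁ h m X
  ψe := NatIso.ofComponents
    (fun X => hypIso (ρ.oneIsoOf rfl X.1) (ρ.oneIsoOf (conjElt_one hς) X.2.unop))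
    (fun f => Prod.ext (ρ.oneIsoOf_nat rfl _)
      (Quiver.Hom.unop_inj (ρ.oneIsoOf_inv_nat (conjElt_one hς) _).symm))
  nat_even_even _ _ _ _ _ _ _ := Prod.ext (ρ.scale_mulIso_nat _ _ _)
    (Quiver.Hom.unop_inj (ρ.scale_mulIso_inv_nat _ _ _))
  nat_even_odd _ _ _ _ _ _ _ := Prod.ext (ρ.scale_mulIso_nat _ _ _)
    (Quiver.Hom.unop_inj (ρ.scale_mulIso_inv_nat _ _ _))
  nat_odd_even _ _ _ _ _ _ _ := Prod.ext (ρ.scale_mulIso_nat _ _ _)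
    (Quiver.Hom.unop_inj (ρ.scale_mulIso_inv_nat _ _ _))
  nat_odd_odd _ _ _ _ _ _ _ := Prod.ext (ρ.scale_mulIso_nat _ _ _)
    (Quiver.Hom.unop_inj (ρ.scale_mulIso_inv_nat _ _ _))
  assoc h₃ h₂ h₁ h₃₂ h₂₁ h m₃₂ m₂₁ m m' X := ρ.hyp_assoc hς h₃ h₂ h₁ h₃₂ h₂₁ h m₃₂ m₂₁ m m' X
  unit_left {ε ω} h X := by
    cases ε
    · refine congrArg₂ hypIso (ρ.mulIso_one_left rfl _ ?_ _)
        (ρ.mulIso_one_left (Subtype.ext ?_) _ ?_ _) <;> simp [conjElt]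
    · refine congrArg₂ hypIso (ρ.mulIso_one_left rfl _ ?_ _)
        (ρ.mulIso_one_left (Subtype.ext ?_) _ ?_ _) <;> simp [conjElt]
  unit_right {ε ω} h X := by
    cases ε
    · refine congrArg₂ hypIso (ρ.mulIso_one_right rfl _ ?_ _)
        (ρ.mulIso_one_right (Subtype.ext ?_) _ ?_ _) <;> simp [conjElt]
    · refine congrArg₂ hypIso (ρ.mulIso_one_right (Subtype.ext ?_) _ ?_ _)
        (ρ.mulIso_one_right rfl _ ?_ _) <;> simp [conjElt]

end TwistedRep

end Hyperbolic

/-! ### Categorical traces and Real 2-characters -/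

section Character

variable {k : Type*} [Field k] {Γ : Type*} [Group Γ] {π : Γ →* ℤˣ}

section Squares

variable {C D : Type*} [Category C] [Category D] {X Y Z X' Y' Z' : C}

lemma square_comp {u : X ⟶ X'} {v : Y ⟶ Y'} {w : Z ⟶ Z'} {a : X ⟶ Y} {b : Y ⟶ Z} {a' : X' ⟶ Y'}
    {b' : Y' ⟶ Z'} (h : u ≫ a' = a ≫ v) (h' : v ≫ b' = b ≫ w) :
    u ≫ a' ≫ b' = (a ≫ b) ≫ w := by
  rw [reassoc_of% h, h', Category.assoc]

lemma square_inv {u : X ⟶ X'} {v : Y ⟶ Y'} {a : X ≅ Y} {a' : X' ≅ Y'}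
    (h : u ≫ a'.hom = a.hom ≫ v) : v ≫ a'.inv = a.inv ≫ u := by
  rw [Iso.comp_inv_eq, Category.assoc, h, Iso.inv_hom_id_assoc]

lemma square_map (F : C ⥤ D) {u : X ⟶ X'} {v : Y ⟶ Y'} {a : X ⟶ Y} {a' : X' ⟶ Y'}
    (h : u ≫ a' = a ≫ v) : F.map u ≫ F.map a' = F.map a ≫ F.map v := by
  rw [← F.map_comp, h, F.map_comp]

lemma square_map_op (F : Cᵒᵖ ⥤ D) {u : X ⟶ X'} {v : Y ⟶ Y'} {a : X ⟶ Y} {a' : X' ⟶ Y'}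
    (h : u ≫ a' = a ≫ v) : F.map v.op ≫ F.map a.op = F.map a'.op ≫ F.map u.op := by
  rw [← F.map_comp, ← F.map_comp, ← op_comp, ← op_comp, h]

lemma sandwich_add [Preadditive C] [Preadditive D] (F : C ⥤ D) [F.Additive] {A B : D}
    (p : A ⟶ F.obj X) (f f' : X ⟶ Y) (q : F.obj Y ⟶ B) :
    p ≫ F.map (f + f') ≫ q = p ≫ F.map f ≫ q + p ≫ F.map f' ≫ q := by
  simp

lemma sandwich_smul {k : Type*} [Field k] [Preadditive C] [Preadditive D] [Linear k C] [Linear k D]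
    (F : C ⥤ D) [F.Linear k] {A B : D} (p : A ⟶ F.obj X) (a : k) (f : X ⟶ Y) (q : F.obj Y ⟶ B) :
    p ≫ F.map (a • f) ≫ q = a • (p ≫ F.map f ≫ q) := by
  simp

end Squares

namespace TwistedRep

variable {α : TwistedCocycle k π} {V : Type u} [Category.{v} V] [Preadditive V] [Linear k V]

instance (ρ : TwistedRep π α V) {g : Γ} (h : π g = Parity.even.sign) : (ρ.act h).cov.Additive :=
  (ρ.linear h).1

instance (ρ : TwistedRep π α V) {g : Γ} (h : π g = Parity.even.sign) : (ρ.act h).cov.Linear k :=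
  (ρ.linear h).2

instance (ρ : TwistedRep π α V) {g : Γ} (h : π g = Parity.odd.sign) : (ρ.act h).contra.Additive :=
  (ρ.linear h).1

instance (ρ : TwistedRep π α V) {g : Γ} (h : π g = Parity.odd.sign) : (ρ.act h).contra.Linear k :=
  (ρ.linear h).2

/-- The categorical trace `Tr_ρ(g) = Hom(1_V, ρ(g))`, for `g ∈ G`. -/
abbrev Tr (ρ : TwistedRep π α V) {g : Γ} (hg : π g = Parity.even.sign) : Type (max u v) :=
  𝟭 V ⟶ (ρ.act hg).cov

/-- The isomorphism `ρ(ω)(ρ(ω⁻¹) x) ≅ ρ(1) x ≅ x`. -/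
def invIso (ρ : TwistedRep π α V) {ω : Γ} {ε : Parity} (h : π ω = ε.sign) (x : V) :
    (ρ.act h).obj ((ρ.act (sign_inv h)).obj x) ≅ x :=
  ρ.ψ h (sign_inv h) (sign_one π) (mul_inv_cancel ω) x ≪≫ ρ.ψe.app x

lemma invIso_nat_even (ρ : TwistedRep π α V) {ω : Γ} (h : π ω = Parity.even.sign) {x y : V}
    (f : x ⟶ y) :
    (ρ.act h).cov.map ((ρ.act (sign_inv h)).cov.map f) ≫ (ρ.invIso h y).hom =
      (ρ.invIso h x).hom ≫ f := by
  exact square_comp (ρ.nat_even_even h (sign_inv h) (sign_one π) (mul_inv_cancel ω) f)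
    (ρ.ψe.hom.naturality f)

lemma invIso_nat_odd (ρ : TwistedRep π α V) {ω : Γ} (h : π ω = Parity.odd.sign) {x y : V}
    (f : x ⟶ y) :
    (ρ.act h).contra.map ((ρ.act (sign_inv h)).contra.map f.op).op ≫ (ρ.invIso h y).hom =
      (ρ.invIso h x).hom ≫ f := by
  exact square_comp (ρ.nat_odd_odd h (sign_inv h) (sign_one π) (mul_inv_cancel ω) f)
    (ρ.ψe.hom.naturality f)

/-- For `φ : 1_V ⟹ ρ(g)`, the natural transformation `ρ(g⁻¹) ⟹ ρ(g⁻¹) ρ(g) ⟹ ρ(1) ⟹ 1_V`. -/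
def mate (ρ : TwistedRep π α V) {g : Γ} {hg : π g = Parity.even.sign} (φ : ρ.Tr hg) (y : V) :
    (ρ.act (sign_inv hg)).cov.obj y ⟶ y :=
  (ρ.act (sign_inv hg)).cov.map (φ.app y) ≫
    (ρ.ψ (sign_inv hg) hg (sign_one π) (inv_mul_cancel g) y).hom ≫ ρ.ψe.hom.app y

lemma mate_nat (ρ : TwistedRep π α V) {g : Γ} {hg : π g = Parity.even.sign} (φ : ρ.Tr hg)
    {x y : V} (f : x ⟶ y) :
    (ρ.act (sign_inv hg)).cov.map f ≫ ρ.mate φ y = ρ.mate φ x ≫ f := by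
  exact square_comp (square_map _ (φ.naturality f))
    (square_comp (ρ.nat_even_even (sign_inv hg) hg (sign_one π) (inv_mul_cancel g) f)
      (ρ.ψe.hom.naturality f))

lemma mate_add (ρ : TwistedRep π α V) {g : Γ} {hg : π g = Parity.even.sign} (φ φ' : ρ.Tr hg)
    (y : V) : ρ.mate (φ + φ') y = ρ.mate φ y + ρ.mate φ' y := by
  simp [mate]

lemma mate_smul (ρ : TwistedRep π α V) {g : Γ} {hg : π g = Parity.even.sign} (a : k)
    (φ : ρ.Tr hg) (y : V) : ρ.mate (a • φ) y = a • ρ.mate φ y := by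
  simp [mate]

/-- The component at `x` of the image of `φ` under `β_{g,ω}`, for `π(ω) = 1` and
`g' = ω g ω⁻¹`:
`x ⟶ ρ(ω)ρ(ω⁻¹)x ⟶ ρ(ω)ρ(g)ρ(ω⁻¹)x ⟶ ρ(ωg)ρ(ω⁻¹)x ⟶ ρ(g')ρ(ω)ρ(ω⁻¹)x ⟶ ρ(g')x`. -/
def betaEvenApp (ρ : TwistedRep π α V) {g ω g' : Γ} {hg : π g = Parity.even.sign}
    (hω : π ω = Parity.even.sign) (hg' : π g' = Parity.even.sign) (m : g' * ω = ω * g)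
    (φ : ρ.Tr hg) (x : V) : x ⟶ (ρ.act hg').cov.obj x :=
  have h : π (ω * g) = Parity.even.sign := by rw [map_mul, hω, hg]; rfl
  let y := (ρ.act (sign_inv hω)).cov.obj x
  (ρ.invIso hω x).inv ≫ (ρ.act hω).cov.map (φ.app y) ≫ (ρ.ψ hω hg h rfl y).hom ≫
    (ρ.ψ hg' hω h m y).inv ≫ (ρ.act hg').cov.map (ρ.invIso hω x).hom

/-- The component at `x` of the image of `φ` under `β_{g,ω}`, for `π(ω) = -1` and
`g' = ω g⁻¹ ω⁻¹`:
`x ⟶ ρ(ω)ρ(ω⁻¹)x ⟶ ρ(ω)ρ(g⁻¹)ρ(ω⁻¹)x ⟶ ρ(ωg⁻¹)ρ(ω⁻¹)x ⟶ ρ(g')ρ(ω)ρ(ω⁻¹)x ⟶ ρ(g')x`,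
where the second map is the value of the contravariant functor `ρ(ω)` on `ρ(g⁻¹) ⟹ 1_V`. -/
def betaOddApp (ρ : TwistedRep π α V) {g ω g' : Γ} {hg : π g = Parity.even.sign}
    (hω : π ω = Parity.odd.sign) (hg' : π g' = Parity.even.sign) (m : g' * ω = ω * g⁻¹)
    (φ : ρ.Tr hg) (x : V) : x ⟶ (ρ.act hg').cov.obj x :=
  have h : π (ω * g⁻¹) = Parity.odd.sign := by rw [map_mul, hω, sign_inv hg]; rfl
  let y := (ρ.act (sign_inv hω)).contra.obj (op x)
  (ρ.invIso hω x).inv ≫ (ρ.act hω).contra.map (ρ.mate φ y).op ≫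
    (ρ.ψ hω (sign_inv hg) h rfl y).hom ≫ (ρ.ψ hg' hω h m y).inv ≫
      (ρ.act hg').cov.map (ρ.invIso hω x).hom

lemma betaEvenApp_nat (ρ : TwistedRep π α V) {g ω g' : Γ} {hg : π g = Parity.even.sign}
    (hω : π ω = Parity.even.sign) (hg' : π g' = Parity.even.sign) (m : g' * ω = ω * g)
    (φ : ρ.Tr hg) {x y : V} (f : x ⟶ y) :
    f ≫ ρ.betaEvenApp hω hg' m φ y = ρ.betaEvenApp hω hg' m φ x ≫ (ρ.act hg').cov.map f := by
  have h : π (ω * g) = Parity.even.sign := by rw [map_mul, hω, hg]; rfl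
  let a := (ρ.act (sign_inv hω)).cov.map f
  exact square_comp (square_inv (ρ.invIso_nat_even hω f))
    (square_comp (square_map _ (φ.naturality a))
      (square_comp (ρ.nat_even_even hω hg h rfl a)
        (square_comp (square_inv (ρ.nat_even_even hg' hω h m a))
          (square_map _ (ρ.invIso_nat_even hω f)))))

lemma betaOddApp_nat (ρ : TwistedRep π α V) {g ω g' : Γ} {hg : π g = Parity.even.sign}
    (hω : π ω = Parity.odd.sign) (hg' : π g' = Parity.even.sign) (m : g' * ω = ω * g⁻¹)
    (φ : ρ.Tr hg) {x y : V} (f : x ⟶ y) :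
    f ≫ ρ.betaOddApp hω hg' m φ y = ρ.betaOddApp hω hg' m φ x ≫ (ρ.act hg').cov.map f := by
  have h : π (ω * g⁻¹) = Parity.odd.sign := by rw [map_mul, hω, sign_inv hg]; rfl
  let a := (ρ.act (sign_inv hω)).contra.map f.op
  exact square_comp (square_inv (ρ.invIso_nat_odd hω f))
    (square_comp (square_map_op _ (ρ.mate_nat φ a))
      (square_comp (ρ.nat_odd_even hω (sign_inv hg) h rfl a)
        (square_comp (square_inv (ρ.nat_even_odd hg' hω h m a))
          (square_map _ (ρ.invIso_nat_odd hω f)))))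

/-- The linear map `β_{g,ω} : Tr_ρ(g) ⟶ Tr_ρ(ωgω⁻¹)`, for `π(ω) = 1`. -/
def betaEven (ρ : TwistedRep π α V) {g ω g' : Γ} (hg : π g = Parity.even.sign)
    (hω : π ω = Parity.even.sign) (hg' : π g' = Parity.even.sign) (m : g' * ω = ω * g) :
    ρ.Tr hg →ₗ[k] ρ.Tr hg' where
  toFun φ :=
    { app := ρ.betaEvenApp hω hg' m φ
      naturality := fun _ _ f => ρ.betaEvenApp_nat hω hg' m φ f }
  map_add' φ φ' := NatTrans.ext <| funext fun _ =>
    sandwich_add (ρ.act hω).cov _ (φ.app _) (φ'.app _) _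
  map_smul' a φ := NatTrans.ext <| funext fun _ =>
    sandwich_smul (ρ.act hω).cov _ a (φ.app _) _

/-- The linear map `β_{g,ω} : Tr_ρ(g) ⟶ Tr_ρ(ωg⁻¹ω⁻¹)`, for `π(ω) = -1`. -/
def betaOdd (ρ : TwistedRep π α V) {g ω g' : Γ} (hg : π g = Parity.even.sign)
    (hω : π ω = Parity.odd.sign) (hg' : π g' = Parity.even.sign) (m : g' * ω = ω * g⁻¹) :
    ρ.Tr hg →ₗ[k] ρ.Tr hg' where
  toFun φ :=
    { app := ρ.betaOddApp hω hg' m φ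
      naturality := fun _ _ f => ρ.betaOddApp_nat hω hg' m φ f }
  map_add' φ φ' := NatTrans.ext <| funext fun x => by
    refine Eq.trans ?_ (sandwich_add (ρ.act hω).contra _ (ρ.mate φ _).op (ρ.mate φ' _).op _)
    rw [← op_add, ← mate_add]
    rfl
  map_smul' a φ := NatTrans.ext <| funext fun x => by
    refine Eq.trans ?_ (sandwich_smul (ρ.act hω).contra _ a (ρ.mate φ _).op _)
    rw [← op_smul', ← mate_smul]
    rfl

open Classical in
/-- The Real 2-character `χ_ρ(g, ω)`, the trace of `β_{g,ω}` on `Tr_ρ(g)`, for `g ∈ G` and `ω ∈ Γ`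
with `ω g ^ π(ω) = g ω`. It is meaningful when `Tr_ρ(g)` is finite dimensional. For `π = 1` this is the 2-character. The value is `0` by convention for
other pairs. -/
noncomputable def char (ρ : TwistedRep π α V) (g ω : Γ) : k :=
  if h : π g = 1 ∧ π ω = 1 ∧ g * ω = ω * g then
    LinearMap.trace k (ρ.Tr (g := g) h.1) (ρ.betaEven h.1 h.2.1 h.1 h.2.2)
  else if h : π g = 1 ∧ π ω = -1 ∧ g * ω = ω * g⁻¹ then
    LinearMap.trace k (ρ.Tr (g := g) h.1) (ρ.betaOdd h.1 h.2.1 h.1 h.2.2)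
  else 0

end TwistedRep

/-- The graded commuting pairs: `g ∈ G` and `ω ∈ Γ` with `ω g ^ π(ω) = g ω`. They are the objects
of the loop groupoid of the unoriented loop groupoid of `BΓ`. -/
def GradedCommute (π : Γ →* ℤˣ) (g ω : Γ) : Prop :=
  π g = 1 ∧ ω * g ^ ((π ω : ℤˣ) : ℤ) = g * ω

/-- The Real conjugate `σ g ^ π(σ) σ⁻¹`. -/
def realConj (π : Γ →* ℤˣ) (σ g : Γ) : Γ := σ * g ^ ((π σ : ℤˣ) : ℤ) * σ⁻¹

namespace TwistedCocycle

/-- The reflection twisted transgression of `α`, a 2-cocycle on the groupoid of elements of `G`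
and their Real conjugations by `Γ`. The value `α.transgress ω₂ ω₁ g` is the one on
`[ω₂|ω₁]g`. -/
def transgress (α : TwistedCocycle k π) (ω₂ ω₁ g : Γ) : kˣ :=
  (if π ω₂ = -1 ∧ π ω₁ = -1 then α g g⁻¹ g else 1) *
    (α (realConj π ω₁ g⁻¹) (realConj π ω₁ g) ω₁ *
        α ω₁ (g ^ (-((π ω₁ : ℤˣ) : ℤ))) (g ^ ((π ω₁ : ℤˣ) : ℤ)) /
      α (realConj π ω₁ g⁻¹) ω₁ (g ^ ((π ω₁ : ℤˣ) : ℤ))) ^ ((((π ω₂ : ℤˣ) : ℤ) - 1) / 2) *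
    (α ω₂ ω₁ (g ^ ((π (ω₂ * ω₁) : ℤˣ) : ℤ)) * α (realConj π (ω₂ * ω₁) g) ω₂ ω₁ /
      α ω₂ (ω₁ * g ^ ((π (ω₂ * ω₁) : ℤˣ) : ℤ) * ω₁⁻¹) ω₁)

/-- The further transgression along loops: the value on the morphism `[σ](g, ω)` from the loop
`(g, ω)` to its conjugate by `σ`. -/
def transgress₂ (α : TwistedCocycle k π) (σ g ω : Γ) : kˣ :=
  α.transgress (σ * ω * σ⁻¹) σ g / α.transgress σ ω g

end TwistedCocycle

end Character

end RealTwoRep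

/-! A transformation from the identity to the action of `g` on `W × Wᵒᵖ` amounts to a transformation
`1 ⟹ ρ(g)` together with a transformation `ρ(ς⁻¹gς) ⟹ 1`, and the latter is the mate of some `1 ⟹
ρ(ς⁻¹g⁻¹ς)`. Hence the trace space of the hyperbolic representation at `g` is the direct sum of two
trace spaces of `ρ` (`hIndTr_bijective`), which gives finiteness. An odd `ω` interchanges the two
summands, so its trace vanishes (`hInd_char_odd`). On the other side of the formula the sum is then
empty, because conjugates of `ω` are odd and `H` is even. An even `ω` preserves the summands and
acts on the second one by a conjugation map times an explicit scalar (`hIndTr_conj`).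

For induction from `H`, the trace space at `g` is a retract of a product over `G/H`, and only the
cosets fixed by both `g` and `ω` contribute to the trace (`ind_char`). Together this writes the
character as a sum over the representatives `rⱼ⁻¹` and `rⱼ⁻¹ς⁻¹` of `H \ Γ` (`hInd_ind_char`).

Two facts turn this into the stated average over `Γ`. The scalars coming from the coherence
isomorphisms are inverse values of the double transgression at `rⱼ⁻¹` and `ς⁻¹` (`transgress₂_inv`,
`transgress₂_inv_odd`). The double transgression is also multiplicative in `σ` (`transgress₂_mul`),
and the character of `ρ` changes under conjugation by `h ∈ H` by exactly its value at `h`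
(`char_conj`). So the summand is constant on each coset `Hσ` (`charTerm_mul`), and summing over all
of `Γ` multiplies the sum over representatives by `|H|`. -/

namespace RealTwoRep

/-! ### Scalar identities for the transgressed cocycle. -/

namespace TwistedCocycle

variable {k : Type*} [Field k] {Γ : Type*} [Group Γ] {π : Γ →* ℤˣ}

/-- The scalar `α([ω₂|ω₁|g₀]) α([g₂|ω₂|ω₁]) / α([ω₂|g₁|ω₁])` attached to `g₁ ω₁ = ω₁ g₀` and
`g₂ ω₂ = ω₂ g₁`. -/
def shuffle (α : TwistedCocycle k π) (ω₂ ω₁ g₂ g₁ g₀ : Γ) : kˣ :=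
  α ω₂ ω₁ g₀ * α g₂ ω₂ ω₁ / α ω₂ g₁ ω₁

/-- For even `ω₂` both correction factors have exponent zero. The conjugates are variables tied by
equations without inverses, the form in which products inside `α` can be rewritten when cocycle
identities are combined. -/
lemma transgress_of_even (α : TwistedCocycle k π) {ω₂ ω₁ g g₀ g₁ g₂ : Γ} (h₂ : π ω₂ = 1)
    (h₀ : g₀ = g ^ ((π ω₁ : ℤˣ) : ℤ)) (h₁ : g₁ * ω₁ = ω₁ * g₀) (h₃ : g₂ * ω₂ = ω₂ * g₁) :
    α.transgress ω₂ ω₁ g = α.shuffle ω₂ ω₁ g₂ g₁ g₀ := by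
  have e₁ : g₁ = ω₁ * g₀ * ω₁⁻¹ := by rw [← h₁, mul_inv_cancel_right]
  have e₂ : g₂ = ω₂ * g₁ * ω₂⁻¹ := by rw [← h₃, mul_inv_cancel_right]
  subst e₂ e₁ h₀
  simp [transgress, shuffle, realConj, h₂, mul_assoc]

/-- Here `δ = 0` and the other correction has exponent `-1`. The correction depends only on `ω₁` and
`g`, not on `ω₂`; it is `mateCoeff` for `ω₁` and the pair `g⁻¹`, `g`. -/
lemma transgress_of_odd_even (α : TwistedCocycle k π) {ω₂ ω₁ g g₂ : Γ} (h₂ : π ω₂ = -1)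
    (h₁ : π ω₁ = 1) (hg : ω₁ * g = g * ω₁) (h₃ : g₂ * ω₂ = ω₂ * g⁻¹) :
    α.transgress ω₂ ω₁ g = (α g⁻¹ g ω₁ * α ω₁ g⁻¹ g / α g⁻¹ ω₁ g)⁻¹ *
      α.shuffle ω₂ ω₁ g₂ g⁻¹ g⁻¹ := by
  have e₂ : g₂ = ω₂ * g⁻¹ * ω₂⁻¹ := by rw [← h₃, mul_inv_cancel_right]
  have hg' : ω₁ * g⁻¹ = g⁻¹ * ω₁ := by
    rw [mul_inv_eq_iff_eq_mul, mul_assoc, hg, inv_mul_cancel_left]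
  subst e₂
  simp [transgress, shuffle, realConj, h₂, h₁, hg, hg', mul_assoc]

/-- The right side is the double transgression at `r` of the conjugated pair `(h, w)`, so this is
multiplicativity for `r r⁻¹ = 1`. The twelve cocycle identities used are indexed by the shuffles of
the words `(r, r⁻¹)`, `(ω)`, `(g)`, where a letter is conjugated when it passes another, and they
enter with the shuffle signs. -/
lemma transgress₂_inv (α : TwistedCocycle k π) {g ω r h w : Γ} (hr : π r = 1) (hg : π g = 1)
    (hω : π ω = 1) (e : g * ω = ω * g) (e₁ : g * r = r * h) (e₂ : ω * r = r * w) :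
    (α.transgress₂ r⁻¹ g ω)⁻¹ = α.coeff ω g r r r w h / α.coeff g ω r r r h w := by
  have hri : π r⁻¹ = 1 := by simp [hr]
  have hh : h = r⁻¹ * g * r := by rw [mul_assoc, e₁, inv_mul_cancel_left]
  have hw : w = r⁻¹ * ω * r := by rw [mul_assoc, e₂, inv_mul_cancel_left]
  have e₃ : h * r⁻¹ = r⁻¹ * g := by simp [hh]
  have e₄ : w * r⁻¹ = r⁻¹ * ω := by simp [hw]
  have e₅ : w * h = h * w := by
    simp only [hh, hw, mul_assoc, mul_inv_cancel_left]
    rw [← mul_assoc ω, ← e, mul_assoc]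
  have hπh : π h = 1 := by simp [hh, hg]
  have hπw : π w = 1 := by simp [hw, hω]
  have hrw : r⁻¹ * ω * r⁻¹⁻¹ = w := by simp [hw]
  rw [transgress₂, hrw, α.transgress_of_even (g₀ := g) (g₁ := h) (g₂ := h) hπw (by simp [hri]) e₃
    e₅.symm, α.transgress_of_even (g₀ := g) (g₁ := g) (g₂ := h) hri (by simp [hω]) e e₃]
  have z := fun a b c d => congrArg Additive.ofMul (α.cocycle a b c d)
  have z₁ := z r w r⁻¹ g
  have z₂ := z ω r r⁻¹ g
  have z₃ := z ω r h r⁻¹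
  have z₄ := z r w h r⁻¹
  have z₅ := z r r⁻¹ ω g
  have z₆ := z r r⁻¹ g ω
  have z₇ := z r h r⁻¹ ω
  have z₈ := z g r r⁻¹ ω
  have z₉ := z g r w r⁻¹
  have z₁₀ := z r h w r⁻¹
  have z₁₁ := z ω g r r⁻¹
  have z₁₂ := z g ω r r⁻¹
  clear z
  apply Additive.ofMul.injective
  simp only [shuffle, coeff, hr, hg, hω, hri, hπh, hπw, e₁, e₂, e₃, e₄, e₅, e, mul_inv_cancel,
    one_left, one_mid, one_right, ofMul_mul, ofMul_div, ofMul_inv, ofMul_one, ofMul_zpow,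
    Units.val_one] at *
  linear_combination (norm := module) z₁ - z₂ + z₃ - z₄ - z₅ + z₆ - z₇ + z₈ - z₉ + z₁₀ - z₁₁ + z₁₂

/-- The prism `Δ² × Δ¹ × Δ¹` is cut into twelve 4-simplices, one for each shuffle of the words `(x,
σ)`, `(ω)`, `(g)`. The signed sum of the cocycle identities on these simplices is the claim, written
additively. -/
lemma transgress₂_mul (α : TwistedCocycle k π) {x σ g ω : Γ} (hx : π x = 1) (hg : π g = 1)
    (hω : π ω = 1) (e : g * ω = ω * g) :
    α.transgress₂ (x * σ) g ω =
      α.transgress₂ x (realConj π σ g) (σ * ω * σ⁻¹) * α.transgress₂ σ g ω := by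
  obtain ⟨g₀, hg₀⟩ : ∃ g₀, g₀ = g ^ ((π σ : ℤˣ) : ℤ) := ⟨_, rfl⟩
  obtain ⟨g₁, hg₁⟩ : ∃ g₁, g₁ = realConj π σ g := ⟨_, rfl⟩
  obtain ⟨ω₁, hω₁⟩ : ∃ ω₁, ω₁ = σ * ω * σ⁻¹ := ⟨_, rfl⟩
  obtain ⟨g₂, hg₂⟩ : ∃ g₂, g₂ = x * g₁ * x⁻¹ := ⟨_, rfl⟩
  obtain ⟨ω₂, hω₂⟩ : ∃ ω₂, ω₂ = x * ω₁ * x⁻¹ := ⟨_, rfl⟩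
  have hxω : x * σ * ω * (x * σ)⁻¹ = ω₂ := by simp [hω₂, hω₁, mul_assoc]
  have e₀ : g₀ * ω = ω * g₀ := by
    rw [hg₀]; exact (Commute.zpow_left (show Commute g ω from e) _)
  have e₁ : g₁ * σ = σ * g₀ := by simp [hg₁, hg₀, realConj]
  have e₂ : ω₁ * σ = σ * ω := by simp [hω₁]
  have e₃ : g₂ * x = x * g₁ := by simp [hg₂]
  have e₄ : ω₂ * x = x * ω₁ := by simp [hω₂]
  have hg₁' : g₁ = σ * g₀ * σ⁻¹ := by rw [← e₁, mul_inv_cancel_right]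
  have e₅ : g₁ * ω₁ = ω₁ * g₁ := by
    simp only [hg₁', hω₁, mul_assoc, inv_mul_cancel_left]
    rw [← mul_assoc ω, ← e₀, mul_assoc]
  have e₆ : g₂ * ω₂ = ω₂ * g₂ := by
    simp only [hg₂, hω₂, mul_assoc, inv_mul_cancel_left]
    rw [← mul_assoc ω₁, ← e₅, mul_assoc]
  have hπg₀ : π g₀ = 1 := by simp [hg₀, hg]
  have hπg₁ : π g₁ = 1 := by simp [hg₁', hπg₀]
  have hπω₁ : π ω₁ = 1 := by simp [hω₁, hω]
  have hπg₂ : π g₂ = 1 := by simp [hg₂, hπg₁]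
  have hπω₂ : π ω₂ = 1 := by simp [hω₂, hπω₁]
  have e₇ : g₁ * (σ * ω) = σ * ω * g₀ := by rw [← mul_assoc, e₁, mul_assoc, e₀, mul_assoc]
  have e₈ : g₂ * (x * σ) = x * σ * g₀ := by rw [← mul_assoc, e₃, mul_assoc, e₁, mul_assoc]
  rw [← hg₁, ← hω₁]
  simp only [transgress₂, hxω]
  rw [← hω₂, ← hω₁,
    α.transgress_of_even (g₀ := g₀) (g₁ := g₂) (g₂ := g₂) hπω₂ (by simp [hg₀, hx]) e₈ e₆,
    α.transgress_of_even (g₀ := g₁) (g₁ := g₂) (g₂ := g₂) hπω₂ (by simp [hx]) e₃ e₆,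
    α.transgress_of_even (g₀ := g₁) (g₁ := g₁) (g₂ := g₂) hx (by simp [hπω₁]) e₅ e₃,
    α.transgress_of_even (g₀ := g₀) (g₁ := g₁) (g₂ := g₁) hπω₁ hg₀ e₁ e₅]
  have z := fun a b c d => congrArg Additive.ofMul (α.cocycle a b c d)
  have z₁ := z ω₂ g₂ x σ
  have z₂ := z g₂ ω₂ x σ
  have z₃ := z x σ ω g₀
  have z₄ := z x σ g₀ ω
  have z₅ := z ω₂ x g₁ σ
  have z₆ := z x ω₁ g₁ σ
  have z₇ := z ω₂ x σ g₀
  have z₈ := z x ω₁ σ g₀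
  have z₉ := z g₂ x ω₁ σ
  have z₁₀ := z x g₁ ω₁ σ
  have z₁₁ := z g₂ x σ ω
  have z₁₂ := z x g₁ σ ω
  clear z
  rcases Int.units_eq_one_or (π σ) with hσ | hσ
  · have hg₀' : g₀ = g := by simp [hg₀, hσ]
    rw [α.transgress_of_even (g₀ := g) (g₁ := g₀) (g₂ := g₂) (by simp [hx, hσ])
        (by simp [hω]) (by rw [hg₀', e]) e₈,
      α.transgress_of_even (g₀ := g) (g₁ := g₀) (g₂ := g₁) hσ
        (by simp [hω]) (by rw [hg₀', e]) e₁, ← hg₀']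
    apply Additive.ofMul.injective
    simp only [shuffle, hx, hσ, hπg₀, hπg₁, hπg₂, hπω₁, hπω₂, hω, e₀, e₁, e₂, e₃, e₄, e₅, e₆,
      ofMul_mul, ofMul_div, ofMul_zpow, Units.val_one] at *
    linear_combination (norm := module)
      -z₁ + z₂ - z₃ + z₄ + z₅ - z₆ - z₇ + z₈ - z₉ + z₁₀ + z₁₁ - z₁₂
  -- For odd `σ`, the correction factors of the transgressions at `(x σ, ω)` and at `(σ, ω)`
  -- coincide and cancel. What remains is the same combination as in the even case, with `g⁻¹` in
  -- place of `g`.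
  · have hg₀' : g₀ = g⁻¹ := by simp [hg₀, hσ]
    rw [α.transgress_of_odd_even (g₂ := g₂) (by simp [hx, hσ]) hω e.symm (by rw [← hg₀', e₈]),
      α.transgress_of_odd_even (g₂ := g₁) hσ hω e.symm (by rw [← hg₀', e₁]), ← hg₀']
    apply Additive.ofMul.injective
    simp only [shuffle, hx, hσ, hπg₀, hπg₁, hπg₂, hπω₁, hπω₂, hω, e₀, e₁, e₂, e₃, e₄, e₅, e₆,
      ofMul_mul, ofMul_div, ofMul_zpow, ofMul_inv, Units.val_one] at *
    linear_combination (norm := module)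
      -z₁ + z₂ - z₃ + z₄ + z₅ - z₆ - z₇ + z₈ - z₉ + z₁₀ + z₁₁ - z₁₂

/-- The scalar of the second component of `HInd(ψ)_{g₂,g₁}`, for `gᵢ ς = ς aᵢ`. -/
def hypCoeff (α : TwistedCocycle k π) (ς g₂ g₁ a₂ a₁ : Γ) : kˣ :=
  α g₂ ς a₁ / (α g₂ g₁ ς * α ς a₂ a₁)

/-- The scalar by which conjugation by `w` fails to commute with the passage to mates, for
`a b = 1`. -/
def mateCoeff (α : TwistedCocycle k π) (w a b : Γ) : kˣ :=
  α a w b / (α a b w * α w a b)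

/-- Three families of identities combine: the twelve shuffles of `(ς, ς⁻¹)`, `(ω)`, `(g⁻¹)` express
`ς ς⁻¹ = 1`; the twelve shuffles of `(g, g⁻¹)`, `(ω)`, `(ς)` pass from the loop `g⁻¹` back to `g`;
the four shuffles of `ω` into `(g, g⁻¹, g)` compare the mate corrections for `g⁻¹ g = 1` and `g g⁻¹
= 1`. -/
lemma transgress₂_inv_odd (α : TwistedCocycle k π) {ς g ω a b w : Γ} (hς : π ς = -1)
    (hg : π g = 1) (hω : π ω = 1) (e : g * ω = ω * g) (e₁ : g * ς = ς * a) (e₂ : ω * ς = ς * w)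
    (hab : a * b = 1) :
    (α.transgress₂ ς⁻¹ g ω)⁻¹ =
      α.hypCoeff ς ω g w a / (α.hypCoeff ς g ω a w * α.mateCoeff w a b) := by
  have ha : a = ς⁻¹ * g * ς := by rw [mul_assoc, e₁, inv_mul_cancel_left]
  have hw : w = ς⁻¹ * ω * ς := by rw [mul_assoc, e₂, inv_mul_cancel_left]
  have hb : b = ς⁻¹ * g⁻¹ * ς := by
    rw [eq_inv_of_mul_eq_one_right hab, ha]; simp [mul_assoc]
  have hςi : π ς⁻¹ = -1 := by simp [hς]
  have e₃ : a * ς⁻¹ = ς⁻¹ * g := by simp [ha]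
  have e₄ : w * ς⁻¹ = ς⁻¹ * ω := by simp [hw]
  have e₅ : b * ς⁻¹ = ς⁻¹ * g⁻¹ := by simp [hb]
  have e₆ : g⁻¹ * ς = ς * b := by simp [hb, mul_assoc]
  have e₇ : g⁻¹ * ω = ω * g⁻¹ := (Commute.inv_left (show Commute g ω from e))
  have e₈ : a * w = w * a := by
    simp only [ha, hw, mul_assoc, mul_inv_cancel_left]
    rw [← mul_assoc g, e, mul_assoc]
  have e₉ : b * w = w * b := by
    simp only [hb, hw, mul_assoc, mul_inv_cancel_left]
    rw [← mul_assoc g⁻¹, e₇, mul_assoc]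
  have hπa : π a = 1 := by simp [ha, hg]
  have hπb : π b = 1 := by simp [hb, hg]
  have hπw : π w = 1 := by simp [hw, hω]
  have hgi : π g⁻¹ = 1 := by simp [hg]
  have hςw : ς⁻¹ * ω * ς⁻¹⁻¹ = w := by simp [hw]
  rw [transgress₂, hςw, α.transgress_of_even (g₀ := g⁻¹) (g₁ := b) (g₂ := b) hπw (by simp [hς]) e₅
    e₉, α.transgress_of_odd_even (g₂ := b) hςi hω e.symm e₅]
  have z := fun a b c d => congrArg Additive.ofMul (α.cocycle a b c d)
  have z₁ := z g g⁻¹ ω g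
  have z₂ := z g g⁻¹ g ω
  have z₃ := z ς ς⁻¹ g⁻¹ ω
  have z₄ := z ς ς⁻¹ ω g⁻¹
  have z₅ := z g⁻¹ ς w ς⁻¹
  have z₆ := z ς b w ς⁻¹
  have z₇ := z ς b ς⁻¹ ω
  have z₈ := z g⁻¹ ς ς⁻¹ ω
  have z₉ := z g g⁻¹ ς w
  have z₁₀ := z g g⁻¹ ω ς
  have z₁₁ := z ω g g⁻¹ g
  have z₁₂ := z g ω g⁻¹ g
  have z₁₃ := z ω ς b ς⁻¹
  have z₁₄ := z ς w b ς⁻¹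
  have z₁₅ := z ς w ς⁻¹ g⁻¹
  have z₁₆ := z ω ς ς⁻¹ g⁻¹
  have z₁₇ := z g⁻¹ ω ς ς⁻¹
  have z₁₈ := z ω g⁻¹ ς ς⁻¹
  have z₁₉ := z g ω g⁻¹ ς
  have z₂₀ := z ω g g⁻¹ ς
  have z₂₁ := z ω g ς b
  have z₂₂ := z g ω ς b
  have z₂₃ := z g ς b w
  have z₂₄ := z ς a b w
  have z₂₅ := z ω ς a b
  have z₂₆ := z ς w a b
  have z₂₇ := z g ς w b
  have z₂₈ := z ς a w b
  clear z
  apply Additive.ofMul.injective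
  simp only [shuffle, hypCoeff, mateCoeff, hς, hςi, hg, hgi, hω, hπa, hπb, hπw, e₁, e₂, e₃, e₄,
    e₅, e₆, e₇, e₈, e₉, e, hab, mul_inv_cancel, inv_mul_cancel, one_left, one_mid, one_right,
    ofMul_mul, ofMul_div, ofMul_inv, ofMul_one, ofMul_zpow, Units.val_one, Units.val_neg] at *
  linear_combination (norm := module)
    -z₁ + z₂ - z₃ + z₄ + z₅ - z₆ + z₇ - z₈ - z₉ + z₁₀ - z₁₁ + z₁₂ - z₁₃ + z₁₄ - z₁₅ + z₁₆
      - z₁₇ + z₁₈ - z₁₉ + z₂₀ - z₂₁ + z₂₂ + z₂₃ - z₂₄ + z₂₅ - z₂₆ - z₂₇ + z₂₈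

end TwistedCocycle

namespace TwistedRep

/-! ### Conjugation and mates for ungraded representations. -/

section UngradedCalculus

variable {k : Type*} [Field k] {Γ : Type*} [Group Γ] {α : TwistedCocycle k (1 : Γ →* ℤˣ)}
  {V : Type u} [Category.{v} V] [Preadditive V] [Linear k V]

lemma smul_mulIso_assoc (ρ : TwistedRep 1 α V) {g₃ g₂ g₁ g₃₂ g₂₁ g : Γ} (m₃₂ : g₃ * g₂ = g₃₂)
    (m₂₁ : g₂ * g₁ = g₂₁) (m : g₃₂ * g₁ = g) (m' : g₃ * g₂₁ = g) (x : V) :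
    (ρ.mulIso m₃₂ ((ρ.fn g₁).obj x)).hom ≫ (ρ.mulIso m x).hom =
      ((α g₃ g₂ g₁)⁻¹ : kˣ) • ((ρ.fn g₃).map (ρ.mulIso m₂₁ x).hom ≫ (ρ.mulIso m' x).hom) := by
  rw [← ρ.mulIso_assoc m₃₂ m₂₁ m m' x, Units.smul_def, smul_smul]
  simp

/-- The isomorphism `ρ(a)(ρ(b) x) ≅ x`, for `a b = 1`. -/
def cancelIso (ρ : TwistedRep 1 α V) {a b : Γ} (m : a * b = 1) (x : V) :
    (ρ.fn a).obj ((ρ.fn b).obj x) ≅ x :=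
  ρ.mulIso m x ≪≫ ρ.oneIso.app x

lemma cancelIso_nat (ρ : TwistedRep 1 α V) {a b : Γ} (m : a * b = 1) {x y : V} (f : x ⟶ y) :
    (ρ.fn a).map ((ρ.fn b).map f) ≫ (ρ.cancelIso m y).hom = (ρ.cancelIso m x).hom ≫ f :=
  square_comp (ρ.mulIso_nat m f) (ρ.oneIso.hom.naturality f)

lemma oneIso_left_hom (ρ : TwistedRep 1 α V) (g : Γ) (m : 1 * g = g) (x : V) :
    (ρ.mulIso m x).hom = ρ.oneIso.hom.app ((ρ.fn g).obj x) :=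
  congrArg Iso.hom (ρ.oneIso_left g x)

lemma oneIso_right_hom (ρ : TwistedRep 1 α V) (g : Γ) (m : g * 1 = g) (x : V) :
    (ρ.mulIso m x).hom = (ρ.fn g).map (ρ.oneIso.hom.app x) :=
  congrArg Iso.hom (ρ.oneIso_right g x)

/-- The triangle identity for the quasi-inverse functors `ρ(a)` and `ρ(b)` fails by the associator
`α(a, b, a)`. This is the associativity axiom for that triple, with the unit axioms applied to the
outer factors. -/
lemma map_cancelIso (ρ : TwistedRep 1 α V) {a b : Γ} (m : a * b = 1) (m' : b * a = 1) (x : V) :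
    (ρ.fn a).map (ρ.cancelIso m' x).hom =
      (α a b a : k) • (ρ.cancelIso m ((ρ.fn a).obj x)).hom := by
  have h := ρ.mulIso_assoc m m' (one_mul a) (mul_one a) x
  rw [oneIso_left_hom, oneIso_right_hom] at h
  simpa [cancelIso] using h.symm

lemma smul_map_cancelIso (ρ : TwistedRep 1 α V) {a b : Γ} (m : a * b = 1) (m' : b * a = 1)
    (x : V) :
    (ρ.cancelIso m ((ρ.fn a).obj x)).hom =
      ((α a b a)⁻¹ : kˣ) • (ρ.fn a).map (ρ.cancelIso m' x).hom := by
  rw [ρ.map_cancelIso m m', Units.smul_def, smul_smul]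
  simp

/-- Conjugation by `ω` on the categorical traces of an ungraded representation. -/
def conj (ρ : TwistedRep 1 α V) {g ω g' : Γ} (m : g' * ω = ω * g) :
    (𝟭 V ⟶ ρ.fn g) →ₗ[k] (𝟭 V ⟶ ρ.fn g') :=
  ρ.betaEven rfl rfl rfl m

lemma fn_faithful (ρ : TwistedRep 1 α V) (g : Γ) {x y : V} {f f' : x ⟶ y}
    (h : (ρ.fn g).map f = (ρ.fn g).map f') : f = f' := by
  rw [← cancel_epi (ρ.cancelIso (inv_mul_cancel g) x).hom, ← cancelIso_nat, ← cancelIso_nat, h]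

/-- Every object is isomorphic to one in the image of `ρ(ω)`, namely `ρ(ω)ρ(ω⁻¹)x`, and naturality
carries the equality along that isomorphism. -/
lemma tr_ext (ρ : TwistedRep 1 α V) (ω : Γ) {F : V ⥤ V} {φ φ' : 𝟭 V ⟶ F}
    (h : ∀ y, φ.app ((ρ.fn ω).obj y) = φ'.app ((ρ.fn ω).obj y)) : φ = φ' := by
  ext x
  have e := ρ.cancelIso (mul_inv_cancel ω) x
  rw [← cancel_epi e.hom]
  have h₁ := φ.naturality e.hom
  have h₂ := φ'.naturality e.hom
  simp only [Functor.id_map] at h₁ h₂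
  rw [h₁, h₂, h]

lemma conj_app_aux (ρ : TwistedRep 1 α V) {g ω g' n : Γ} (m : g' * ω = n) (m' : ω * g = n)
    (φ : 𝟭 V ⟶ ρ.fn g) (y : V) :
    ((ρ.cancelIso (mul_inv_cancel ω) ((ρ.fn ω).obj y)).inv ≫
      (ρ.fn ω).map (φ.app ((ρ.fn ω⁻¹).obj ((ρ.fn ω).obj y))) ≫ (ρ.mulIso m' _).hom ≫
        (ρ.mulIso m _).inv ≫
          (ρ.fn g').map (ρ.cancelIso (mul_inv_cancel ω) ((ρ.fn ω).obj y)).hom) ≫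
        (ρ.mulIso m y).hom = (ρ.fn ω).map (φ.app y) ≫ (ρ.mulIso m' y).hom := by
  simp only [Category.assoc]
  -- The isomorphism occurs once on each side, so replacing it by `ρ(ω)` of the other cancellation
  -- produces the same scalar `α(ω, ω⁻¹, ω)⁻¹` twice, and it drops out.
  rw [Iso.inv_comp_eq, ρ.smul_map_cancelIso (mul_inv_cancel ω) (inv_mul_cancel ω)]
  have h := φ.naturality (ρ.cancelIso (inv_mul_cancel ω) y).hom
  simp only [Functor.id_map] at h
  simp only [Units.smul_def, Functor.map_smul, Linear.smul_comp, Linear.comp_smul]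
  congr 1
  rw [ρ.mulIso_nat m, ← Functor.map_comp_assoc, h, Functor.map_comp_assoc, ρ.mulIso_nat m',
    Iso.inv_hom_id_assoc]

/-- On objects `ρ(ω)y` the conjugate is described without `ω⁻¹` and without the unit isomorphism. By
`tr_ext` this square determines it, and `conj_eq` is the resulting criterion. -/
lemma conj_app (ρ : TwistedRep 1 α V) {g ω g' n : Γ} (m : g' * ω = n) (m' : ω * g = n)
    (φ : 𝟭 V ⟶ ρ.fn g) (y : V) :
    (ρ.conj (m.trans m'.symm) φ).app ((ρ.fn ω).obj y) ≫
        (ρ.mulIso m y).hom =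
      (ρ.fn ω).map (φ.app y) ≫ (ρ.mulIso m' y).hom := by
  subst m'
  exact ρ.conj_app_aux m rfl φ y

lemma conj_eq (ρ : TwistedRep 1 α V) {g ω g' n : Γ} (m : g' * ω = n) (m' : ω * g = n)
    {φ : 𝟭 V ⟶ ρ.fn g} {φ' : 𝟭 V ⟶ ρ.fn g'}
    (h : ∀ y, φ'.app ((ρ.fn ω).obj y) ≫ (ρ.mulIso m y).hom =
      (ρ.fn ω).map (φ.app y) ≫ (ρ.mulIso m' y).hom) :
    ρ.conj (m.trans m'.symm) φ = φ' := by
  refine ρ.tr_ext ω fun y => ?_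
  rw [← cancel_mono (ρ.mulIso m y).hom]
  rw [ρ.conj_app m m', h]

lemma conj_one (ρ : TwistedRep 1 α V) {g : Γ} (m : g * 1 = 1 * g) (φ : 𝟭 V ⟶ ρ.fn g) :
    ρ.conj m φ = φ := by
  refine ρ.conj_eq (mul_one g) (one_mul g) fun y => ?_
  rw [oneIso_left_hom, oneIso_right_hom]
  have h₁ := φ.naturality (ρ.oneIso.hom.app y)
  have h₂ := ρ.oneIso.hom.naturality (φ.app y)
  exact h₁.symm.trans h₂.symm

/-- Pasting the two squares of `conj_app` requires reassociating three times, for `(g₂, ω₂, ω₁)`,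
`(ω₂, g₁, ω₁)` and `(ω₂, ω₁, g)`. The three values of `α` are the factors of `shuffle`. -/
lemma conj_conj (ρ : TwistedRep 1 α V) {g g₁ g₂ ω₁ ω₂ ω : Γ} (m₁ : g₁ * ω₁ = ω₁ * g)
    (m₂ : g₂ * ω₂ = ω₂ * g₁) (mω : ω₂ * ω₁ = ω) (m : g₂ * ω = ω * g) (φ : 𝟭 V ⟶ ρ.fn g) :
    ρ.conj m₂ (ρ.conj m₁ φ) = (α.shuffle ω₂ ω₁ g₂ g₁ g : k) • ρ.conj m φ := by
  obtain ⟨φ₁, h₁⟩ : ∃ φ₁ : 𝟭 V ⟶ ρ.fn g₁, φ₁ = ρ.conj m₁ φ := ⟨_, rfl⟩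
  obtain ⟨φ₂, h₂⟩ : ∃ φ₂ : 𝟭 V ⟶ ρ.fn g₂, φ₂ = ρ.conj m₂ φ₁ := ⟨_, rfl⟩
  have s₁ := fun y => ρ.conj_app m₁ rfl φ y
  have s₂ := fun y => ρ.conj_app m₂ rfl φ₁ y
  rw [← h₁] at s₁ ⊢
  rw [← h₂] at s₂ ⊢
  have key : ρ.conj m φ = ((α.shuffle ω₂ ω₁ g₂ g₁ g)⁻¹ : kˣ) • φ₂ := by
    refine ρ.conj_eq m rfl fun y => ?_
    -- Precomposing with `ψ_{ω₂,ω₁}` moves the source to `ρ(ω₂)ρ(ω₁)y`, where the squares `s₂` and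
    -- `ρ(ω₂)(s₁)` apply.
    rw [← cancel_epi (ρ.mulIso mω y).hom]
    have n₂ := φ₂.naturality (ρ.mulIso mω y).hom
    simp only [Functor.id_map] at n₂
    have q : ω₂ * g₁ * ω₁ = ω * g := by rw [mul_assoc, m₁, ← mul_assoc, mω]
    have q' : ω₂ * (ω₁ * g) = ω * g := by rw [← mul_assoc, mω]
    have a₁ := ρ.mulIso_assoc m₂ mω q m y
    have a₂ := ρ.smul_mulIso_assoc (rfl : ω₂ * g₁ = _) m₁ q q' y
    have a₃ := ρ.mulIso_assoc mω (rfl : ω₁ * g = _) rfl q' y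
    have s₁' := congrArg (ρ.fn ω₂).map (s₁ y)
    simp only [Functor.map_comp] at s₁'
    simp only [Units.smul_def, NatTrans.app_smul, Linear.smul_comp,
      Linear.comp_smul]
    rw [← reassoc_of% (ρ.mulIso_nat mω (φ.app y)), reassoc_of% n₂, ← a₁, Linear.comp_smul,
      reassoc_of% (s₂ ((ρ.fn ω₁).obj y)), a₂]
    simp only [Units.smul_def, Linear.comp_smul]
    rw [reassoc_of% s₁', ← a₃]
    simp only [Linear.comp_smul, smul_smul]
    convert one_smul k _
    simp [TwistedCocycle.shuffle]
    field_simp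
  rw [key, Units.smul_def, smul_smul]
  simp

/-- By `conj_conj`, conjugating by `ω` and by `ω⁻¹` in either order is a unit multiple of
conjugation by `1`, which is the identity. -/
lemma conj_bijective (ρ : TwistedRep 1 α V) {g ω g' : Γ} (m : g' * ω = ω * g) :
    Function.Bijective (ρ.conj m) := by
  have m' : g * ω⁻¹ = ω⁻¹ * g' := by
    rw [mul_inv_eq_iff_eq_mul, mul_assoc, m, inv_mul_cancel_left]
  constructor
  · refine (injective_iff_map_eq_zero _).2 fun φ h => ?_
    have h' := ρ.conj_conj m m' (inv_mul_cancel ω) (by simp) φ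
    rw [h, map_zero, conj_one] at h'
    exact (smul_eq_zero.1 h'.symm).resolve_left (Units.ne_zero _)
  · intro φ
    have h' := ρ.conj_conj m' m (mul_inv_cancel ω) (by simp) φ
    rw [conj_one] at h'
    refine ⟨((α.shuffle ω ω⁻¹ g' g g')⁻¹ : kˣ) • ρ.conj m' φ, ?_⟩
    rw [Units.smul_def, map_smul, h', smul_smul]
    simp

lemma char_of_commute (ρ : TwistedRep 1 α V) {g ω : Γ} (m : g * ω = ω * g) :
    ρ.char g ω = LinearMap.trace k (𝟭 V ⟶ ρ.fn g) (ρ.conj m) := by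
  rw [char, dif_pos ⟨rfl, rfl, m⟩]
  rfl

/-- The 2-character is a class function up to scalars. -/
lemma char_conj (ρ : TwistedRep 1 α V) {g ω g₁ ω₁ h : Γ} (m : g * ω = ω * g)
    (mg : g₁ * h = h * g) (mω : ω₁ * h = h * ω) :
    ρ.char g₁ ω₁ =
      ((α.shuffle ω₁ h g₁ g₁ g / α.shuffle h ω g₁ g g : kˣ) : k) * ρ.char g ω := by
  have m₁ : g₁ * ω₁ = ω₁ * g₁ := by
    have e : g₁ = h * g * h⁻¹ := by rw [← mg, mul_inv_cancel_right]
    have e' : ω₁ = h * ω * h⁻¹ := by rw [← mω, mul_inv_cancel_right]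
    simp only [e, e', mul_assoc, inv_mul_cancel_left]
    rw [← mul_assoc g, m, mul_assoc]
  have q : g₁ * (h * ω) = h * ω * g := by rw [← mul_assoc, mg, mul_assoc, m, mul_assoc]
  let E := LinearEquiv.ofBijective (ρ.conj mg) (ρ.conj_bijective mg)
  -- Conjugation by `h ω = ω₁ h` is factored in both ways; the quotient of the two shuffle scalars
  -- measures the discrepancy.
  have hE : E.conj (ρ.conj m) =
      ((α.shuffle h ω g₁ g g / α.shuffle ω₁ h g₁ g₁ g : kˣ) : k) • ρ.conj m₁ := by
    ext1 φ
    obtain ⟨φ, rfl⟩ := E.surjective φ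
    rw [LinearEquiv.conj_apply_apply, LinearEquiv.symm_apply_apply]
    rw [LinearEquiv.ofBijective_apply, LinearEquiv.ofBijective_apply, LinearMap.smul_apply,
      ρ.conj_conj m mg rfl q, ρ.conj_conj mg m₁ mω q, smul_smul]
    simp
  rw [ρ.char_of_commute m, ρ.char_of_commute m₁, ← LinearMap.trace_conj' _ E, hE, map_smul,
    smul_eq_mul, ← mul_assoc, ← Units.val_mul]
  simp

/-- For `a b = 1`, the transformation `ρ(a) ⟹ ρ(a) ρ(b) ⟹ ρ(1) ⟹ 1_V` obtained from a
transformation `1_V ⟹ ρ(b)`. -/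
def mateMap (ρ : TwistedRep 1 α V) {a b : Γ} (m : a * b = 1) :
    (𝟭 V ⟶ ρ.fn b) →ₗ[k] (ρ.fn a ⟶ 𝟭 V) where
  toFun φ :=
    { app := fun x => (ρ.fn a).map (φ.app x) ≫ (ρ.cancelIso m x).hom
      naturality := fun _ _ f => square_comp (square_map _ (φ.naturality f)) (ρ.cancelIso_nat m f) }
  map_add' φ φ' := by
    ext x
    exact (congrArg (· ≫ _) ((ρ.fn a).map_add)).trans (Preadditive.add_comp _ _ _ _ _ _)
  map_smul' c φ := by
    ext x
    exact (congrArg (· ≫ _) ((ρ.fn a).map_smul _ _)).trans (Linear.smul_comp _ _ _ _ _ _)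

lemma mateMap_app (ρ : TwistedRep 1 α V) {a b : Γ} (m : a * b = 1) (φ : 𝟭 V ⟶ ρ.fn b) (x : V) :
    (ρ.mateMap m φ).app x = (ρ.fn a).map (φ.app x) ≫ (ρ.cancelIso m x).hom := rfl

lemma mateMap_bijective (ρ : TwistedRep 1 α V) {a b : Γ} (m : a * b = 1) :
    Function.Bijective (ρ.mateMap m) := by
  have m' : b * a = 1 := mul_eq_one_comm.1 m
  constructor
  · refine (injective_iff_map_eq_zero _).2 fun φ h => ?_
    ext x
    apply ρ.fn_faithful a
    have h' := NatTrans.congr_app h x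
    rw [mateMap_app] at h'
    rw [← cancel_mono (ρ.cancelIso m x).hom, h']
    simp
  · intro θ
    let φ : 𝟭 V ⟶ ρ.fn b :=
      { app := fun x => (ρ.cancelIso m' x).inv ≫ (ρ.fn b).map (θ.app x)
        naturality := fun _ _ f =>
          square_comp (square_inv (ρ.cancelIso_nat m' f)) (square_map _ (θ.naturality f)) }
    -- The naive inverse `φ` is off by the defect of the triangle identity in `map_cancelIso`; the
    -- factor `α(a, b, a)` compensates for it.
    refine ⟨(α a b a : k) • φ, ?_⟩
    rw [map_smul]
    ext x
    rw [NatTrans.app_smul, mateMap_app]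
    simp only [φ, Functor.map_comp, Category.assoc]
    have h := ρ.cancelIso_nat m (θ.app x)
    simp only [Functor.id_obj] at h ⊢
    rw [h, ← Linear.comp_smul, ← Linear.smul_comp, ← map_cancelIso _ _ m', ← Functor.map_comp_assoc]
    simp

/-- Both sides reduce to multiples of the map `ρ(p)(φ) ≫ ψ_{p,b}`, with `p = a w = w a`. The left
one acquires `α(a, w, b) / α(a, b, w)` and the right one `α(w, a, b)`. -/
lemma mateMap_conj (ρ : TwistedRep 1 α V) {a b w n p : Γ} (m : a * b = 1) (mb : b * w = n)
    (mb' : w * b = n) (ma : a * w = p) (ma' : w * a = p) (φ : 𝟭 V ⟶ ρ.fn b) (y : V) :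
    (ρ.mulIso ma y).inv ≫
        (ρ.mateMap m (ρ.conj (mb.trans mb'.symm) φ)).app ((ρ.fn w).obj y) =
      (α.mateCoeff w a b : k) •
        ((ρ.mulIso ma' y).inv ≫ (ρ.fn w).map ((ρ.mateMap m φ).app y)) := by
  obtain ⟨φ', hφ'⟩ : ∃ φ' : 𝟭 V ⟶ ρ.fn b, φ' = ρ.conj (mb.trans mb'.symm) φ := ⟨_, rfl⟩
  have s := ρ.conj_app mb mb' φ y
  rw [← hφ'] at s ⊢
  have qn : a * n = w := by rw [← mb, ← mul_assoc, m, one_mul]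
  have qp : p * b = w := by rw [← ma', mul_assoc, m, mul_one]
  have s' := congrArg (ρ.fn a).map s
  simp only [Functor.map_comp] at s'
  have h₁ : (ρ.mulIso ma y).inv ≫ (ρ.mateMap m φ').app ((ρ.fn w).obj y) =
      ((α a w b / α a b w : kˣ) : k) • ((ρ.fn p).map (φ.app y) ≫ (ρ.mulIso qp y).hom) := by
    rw [Iso.inv_comp_eq, mateMap_app, cancelIso, Iso.trans_hom, Iso.app_hom,
      ← ρ.oneIso_left_hom w (one_mul w), ρ.smul_mulIso_assoc m mb (one_mul w) qn y, Units.smul_def,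
      Linear.comp_smul, reassoc_of% s', ← ρ.mulIso_assoc ma mb' qp qn y]
    simp only [Linear.comp_smul, smul_smul]
    rw [reassoc_of% (ρ.mulIso_nat ma (φ.app y))]
    congr 1
    simp [div_eq_inv_mul]
  have h₂ : (ρ.mulIso ma' y).inv ≫ (ρ.fn w).map ((ρ.mateMap m φ).app y) =
      (α w a b : k) • ((ρ.fn p).map (φ.app y) ≫ (ρ.mulIso qp y).hom) := by
    rw [mateMap_app, cancelIso, Iso.trans_hom, Iso.app_hom, Functor.map_comp, Functor.map_comp,
      ← ρ.oneIso_right_hom w (mul_one w), ← ρ.mulIso_assoc ma' m qp (mul_one w) y]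
    simp only [Linear.comp_smul]
    rw [reassoc_of% (ρ.mulIso_inv_nat ma' (φ.app y)), Iso.inv_hom_id_assoc]
  rw [h₁, h₂, smul_smul, TwistedCocycle.mateCoeff, ← Units.val_mul]
  congr 2
  simp [div_mul_eq_div_div]

end UngradedCalculus

/-! ### Reduction of even character values to `ker π`. -/

section Restriction

variable {k : Type*} [Field k] {Γ : Type*} [Group Γ] {π : Γ →* ℤˣ} {α : TwistedCocycle k π}
  {V : Type u} [Category.{v} V] [Preadditive V] [Linear k V]

/-- The restriction of a Real representation to the ungraded group `ker π`. -/
def resKer (ρ : TwistedRep π α V) : TwistedRep (1 : π.ker →* ℤˣ) (α.res le_rfl) V :=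
  ofUngraded (fun g => (ρ.act (ε := .even) g.2).cov) (fun g => ρ.linear (ε := .even) g.2)
    (fun {g₂ g₁ g} m x => ρ.ψ (ε₂ := .even) (ε₁ := .even) (ε := .even) g₂.2 g₁.2 g.2
      (congrArg Subtype.val m) x)
    ρ.ψe (fun _ _ _ _ => ρ.nat_even_even _ _ _ _ _)
    (fun _ _ _ _ _ => ρ.assoc (ε₃ := .even) (ε₂ := .even) (ε₁ := .even) (ε₃₂ := .even)
      (ε₂₁ := .even) (ε := .even) _ _ _ _ _ _ _ _ _ _ _)
    (fun _ _ => ρ.unit_left (ε := .even) _ _) (fun _ _ => ρ.unit_right (ε := .even) _ _)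

lemma char_resKer (ρ : TwistedRep π α V) (g ω : π.ker) (m : g * ω = ω * g) :
    ρ.char g ω = ρ.resKer.char g ω := by
  rw [char_of_commute _ m, char, dif_pos ⟨g.2, ω.2, congrArg Subtype.val m⟩]
  rfl

end Restriction

end TwistedRep

/-! ### Vanishing lemmas and transformations on `W × Wᵒᵖ`. -/

section MapZero

variable {C D : Type*} [Category C] [Category D] [Preadditive C] [Preadditive D] (F : C ⥤ D)
  [F.Additive] {X Y : C} {f : X ⟶ Y}

lemma map_comp_eq_zero (hf : f = 0) {B : D} (b : F.obj Y ⟶ B) : F.map f ≫ b = 0 := by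
  simp [hf]

lemma comp_map_comp_eq_zero (hf : f = 0) {A B : D} (a : A ⟶ F.obj X) (b : F.obj Y ⟶ B) :
    a ≫ F.map f ≫ b = 0 := by
  simp [hf]

lemma comp_map_op_comp_eq_zero (hf : f = 0) {A B : Dᵒᵖ} (a : A ⟶ op (F.obj Y))
    (b : op (F.obj X) ⟶ B) : a ≫ (F.map f).op ≫ b = 0 :=
  Quiver.Hom.unop_inj (by simp [hf])

end MapZero

section ProdOp

variable {k : Type*} [Field k] {W : Type u} [Category.{v} W] [Preadditive W] [Linear k W]
  (F F' : W ⥤ W)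

/-- Transformations `1 ⟹ F × F'ᵒᵖ` on `W × Wᵒᵖ` from transformations `1 ⟹ F` and `F' ⟹ 1`. -/
def prodOpMap : ((𝟭 W ⟶ F) × (F' ⟶ 𝟭 W)) →ₗ[k] (𝟭 (W × Wᵒᵖ) ⟶ F.prod F'.op) where
  toFun φ :=
    { app := fun X => Prod.mkHom (φ.1.app X.1) (φ.2.app X.2.unop).op
      naturality := fun _ _ f => Prod.ext (φ.1.naturality f.1)
        (Quiver.Hom.unop_inj (φ.2.naturality f.2.unop).symm) }
  map_add' _ _ := rfl
  map_smul' _ _ := rfl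

/-- Naturality along a morphism that is zero in one factor shows that each component of a
transformation depends only on the object in its own factor. The values at the diagonal objects `(x,
op x)` therefore recover everything. -/
lemma prodOpMap_bijective : Function.Bijective (prodOpMap (k := k) F F') := by
  constructor
  · intro φ φ' h
    have h' := fun x => NatTrans.congr_app h (x, op x)
    refine Prod.ext ?_ ?_
    · ext x
      exact congrArg Prod.fst (h' x)
    · ext x
      exact congrArg Quiver.Hom.unop (congrArg Prod.snd (h' x))
  · intro Φ
    have n₁ : ∀ {x x' : W} (y y' : Wᵒᵖ) (f : x ⟶ x'),
        f ≫ (Φ.app (x', y')).1 = (Φ.app (x, y)).1 ≫ F.map f := fun y y' f =>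
      congrArg Prod.fst (Φ.naturality (Prod.mkHom f (0 : y ⟶ y')))
    have n₂ : ∀ {y y' : Wᵒᵖ} (x x' : W) (f : y ⟶ y'),
        f ≫ (Φ.app (x', y')).2 = (Φ.app (x, y)).2 ≫ F'.op.map f := fun x x' f =>
      congrArg Prod.snd (Φ.naturality (Prod.mkHom (0 : x ⟶ x') f))
    refine ⟨({ app := fun x => (Φ.app (x, op x)).1
               naturality := fun _ _ f => n₁ _ _ f },
             { app := fun y => (Φ.app (y, op y)).2.unop
               naturality := fun _ _ f => (congrArg Quiver.Hom.unop (n₂ _ _ f.op)).symm }), ?_⟩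
    ext X
    · have := n₁ (op X.1) X.2 (𝟙 X.1)
      exact (by simpa using this.symm : (Φ.app (X.1, op X.1)).1 = (Φ.app X).1)
    · have := n₂ X.2.unop X.1 (𝟙 X.2)
      exact (by simpa using this.symm : (Φ.app (X.2.unop, X.2)).2 = (Φ.app X).2)

end ProdOp

/-! ### Characters of hyperbolically induced representations. -/

namespace TwistedRep

variable {k : Type*} [Field k] {Γ : Type*} [Group Γ] {π : Γ →* ℤˣ} {ς : Γ}
  {α : TwistedCocycle k π} {W : Type u} [Category.{v} W] [Preadditive W] [Linear k W]

/-- The map from `Tr_ρ(g) × Tr_ρ(b)` to the categorical trace of `HInd(ρ)` at `g`, where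
`b = ς⁻¹ g⁻¹ ς`. -/
def hIndTr (ρ : TwistedRep (1 : π.ker →* ℤˣ) (α.res le_rfl) W) (hς : π ς = -1) {g b : π.ker}
    (m : conjElt hς g.2 * b = 1) :
    ((𝟭 W ⟶ ρ.fn g) × (𝟭 W ⟶ ρ.fn b)) →ₗ[k] (𝟭 (W × Wᵒᵖ) ⟶ (ρ.hInd hς).resKer.fn g) :=
  prodOpMap (ρ.fn g) (ρ.fn (conjElt hς g.2)) ∘ₗ LinearMap.prodMap LinearMap.id (ρ.mateMap m)

lemma hIndTr_bijective (ρ : TwistedRep (1 : π.ker →* ℤˣ) (α.res le_rfl) W) (hς : π ς = -1)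
    {g b : π.ker} (m : conjElt hς g.2 * b = 1) : Function.Bijective (ρ.hIndTr hς m) :=
  (prodOpMap_bijective (k := k) _ _).comp (Function.bijective_id.prodMap (ρ.mateMap_bijective m))

/-- The first coherence component of a pair of even elements carries no scalar. In the second, the
two coherence scalars combine with the `mateCoeff` of `mateMap_conj`. -/
lemma hIndTr_conj (ρ : TwistedRep (1 : π.ker →* ℤˣ) (α.res le_rfl) W) (hς : π ς = -1)
    {g b ω c : π.ker} (m : conjElt hς g.2 * b = 1) (hc : c = conjElt hς ω.2) (e : g * ω = ω * g)
    (e' : b * c = c * b) (φ : (𝟭 W ⟶ ρ.fn g) × (𝟭 W ⟶ ρ.fn b)) :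
    (ρ.hInd hς).resKer.conj e (ρ.hIndTr hς m φ) = ρ.hIndTr hς m
      (ρ.conj e φ.1, ((α.hypCoeff ς ω g c (conjElt hς g.2) /
        (α.hypCoeff ς g ω (conjElt hς g.2) c * α.mateCoeff c (conjElt hς g.2) b) : kˣ) : k) •
          ρ.conj e' φ.2) := by
  subst hc
  have ma' : conjElt hς ω.2 * conjElt hς g.2 = conjElt hς (ω * g).2 :=
    Subtype.ext (by simp [conjElt, mul_assoc])
  have ma : conjElt hς g.2 * conjElt hς ω.2 = conjElt hς (ω * g).2 := by
    simp only [← e]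
    exact Subtype.ext (by simp [conjElt, mul_assoc])
  obtain ⟨c, hc⟩ : ∃ c : kˣ, c = α.hypCoeff ς ω g (conjElt hς ω.2) (conjElt hς g.2) /
    (α.hypCoeff ς g ω (conjElt hς g.2) (conjElt hς ω.2) *
      α.mateCoeff (conjElt hς ω.2) (conjElt hς g.2) b) := ⟨_, rfl⟩
  rw [← hc]
  refine (ρ.hInd hς).resKer.conj_eq e rfl fun Y => ?_
  refine Prod.ext ?_ (Quiver.Hom.unop_inj ?_)
  · change (ρ.conj e φ.1).app ((ρ.fn ω).obj Y.1) ≫ (scaleIso (1 : kˣ) (ρ.mulIso e Y.1)).hom =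
      (ρ.fn ω).map (φ.1.app Y.1) ≫ (scaleIso (1 : kˣ) (ρ.mulIso rfl Y.1)).hom
    simpa using ρ.conj_app e rfl φ.1 Y.1
  · have h := ρ.mateMap_conj m e' rfl ma ma' φ.2 Y.2.unop
    change (scaleIso (α.hypCoeff ς g ω (conjElt hς g.2) (conjElt hς ω.2))⁻¹
        (ρ.mulIso ma Y.2.unop)).inv ≫ (ρ.mateMap m ((c : k) • ρ.conj e' φ.2)).app _ =
      (scaleIso (α.hypCoeff ς ω g (conjElt hς ω.2) (conjElt hς g.2))⁻¹
        (ρ.mulIso ma' Y.2.unop)).inv ≫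
          (ρ.fn (conjElt hς ω.2)).map ((ρ.mateMap m φ.2).app Y.2.unop)
    rw [map_smul, NatTrans.app_smul]
    simp only [scaleIso_inv, inv_inv, Linear.smul_comp, Linear.comp_smul, Functor.id_obj] at h ⊢
    rw [h]
    simp only [smul_smul, ← Units.val_mul, TwistedCocycle.mateCoeff,
      TwistedCocycle.res_toFun] at hc ⊢
    congr 2
    rw [hc]
    exact div_mul_cancel _ _

lemma hInd_char_even (ρ : TwistedRep (1 : π.ker →* ℤˣ) (α.res le_rfl) W) (hς : π ς = -1)
    (hfin : ∀ g, Module.Finite k (𝟭 W ⟶ ρ.fn g))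
    {g b ω c : π.ker} (m : conjElt hς g.2 * b = 1) (hc : c = conjElt hς ω.2) (e : g * ω = ω * g)
    (e' : b * c = c * b) :
    (ρ.hInd hς).char g ω = ρ.char g ω + ((α.hypCoeff ς ω g c (conjElt hς g.2) /
        (α.hypCoeff ς g ω (conjElt hς g.2) c * α.mateCoeff c (conjElt hς g.2) b) : kˣ) : k) *
          ρ.char b c := by
  have := hfin g
  have := hfin b
  rw [char_resKer _ g ω e, char_of_commute _ e, char_of_commute _ e, char_of_commute _ e',
    ← smul_eq_mul, ← map_smul, ← LinearMap.trace_prodMap',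
    ← LinearMap.trace_conj' _ (LinearEquiv.ofBijective _ (ρ.hIndTr_bijective hς m))]
  congr 1
  ext1 φ
  obtain ⟨φ, rfl⟩ := (LinearEquiv.ofBijective _ (ρ.hIndTr_bijective hς m)).surjective φ
  rw [LinearEquiv.conj_apply_apply, LinearEquiv.symm_apply_apply]
  exact ρ.hIndTr_conj hς m hc e e' φ

lemma hInd_tr_finite (ρ : TwistedRep (1 : π.ker →* ℤˣ) (α.res le_rfl) W) (hς : π ς = -1)
    (hfin : ∀ g, Module.Finite k (𝟭 W ⟶ ρ.fn g)) (g : π.ker) :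
    Module.Finite k (𝟭 (W × Wᵒᵖ) ⟶ (ρ.hInd hς).resKer.fn g) := by
  have := hfin g
  have := hfin (conjElt hς g.2)⁻¹
  exact Module.Finite.equiv
    (LinearEquiv.ofBijective _ (ρ.hIndTr_bijective hς (mul_inv_cancel (conjElt hς g.2))))

/-- The projection of `1_{W × Wᵒᵖ}` onto the first factor. -/
def fstProj : 𝟭 (W × Wᵒᵖ) ⟶ 𝟭 (W × Wᵒᵖ) where
  app _ := Prod.mkHom (𝟙 _) 0
  naturality _ _ _ := Prod.ext (by simp) (by simp)

/-- Passing to mates preserves the two factors of `W × Wᵒᵖ`, while the contravariant functor of an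
odd `ω` interchanges them. A vanishing second component thus becomes a vanishing first component. -/
lemma hInd_betaOdd_fst (ρ : TwistedRep (1 : π.ker →* ℤˣ) (α.res le_rfl) W) (hς : π ς = -1)
    {g ω g' : Γ} (hg : π g = 1) (hω : π ω = -1) (hg' : π g' = 1) (m : g' * ω = ω * g⁻¹)
    (φ : (ρ.hInd hς).Tr (g := g) hg) (h : ∀ X, (φ.app X).2 = 0) (X : W × Wᵒᵖ) :
    (((ρ.hInd hς).betaOdd hg hω hg' m φ).app X).1 = 0 := by
  have hz : ∀ Y, ((ρ.hInd hς).mate φ Y).2 = 0 := fun Y =>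
    map_comp_eq_zero (ρ.fn (conjElt hς (sign_inv (ε := .even) hg))).op (h Y) _
  exact comp_map_comp_eq_zero (ρ.fn (mulElt hς hω)) (congrArg Quiver.Hom.unop (hz _)) _ _

lemma hInd_betaOdd_snd (ρ : TwistedRep (1 : π.ker →* ℤˣ) (α.res le_rfl) W) (hς : π ς = -1)
    {g ω g' : Γ} (hg : π g = 1) (hω : π ω = -1) (hg' : π g' = 1) (m : g' * ω = ω * g⁻¹)
    (φ : (ρ.hInd hς).Tr (g := g) hg) (h : ∀ X, (φ.app X).1 = 0) (X : W × Wᵒᵖ) :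
    (((ρ.hInd hς).betaOdd hg hω hg' m φ).app X).2 = 0 := by
  have hz : ∀ Y, ((ρ.hInd hς).mate φ Y).1 = 0 := fun Y =>
    map_comp_eq_zero (ρ.fn (evenElt (sign_inv (ε := .even) hg))) (h Y) _
  exact comp_map_op_comp_eq_zero (ρ.fn (invMulElt hς hω)) (hz _) _ _

/-- With respect to the splitting given by `P`, precomposition with the first projection, the map
`β` is block off-diagonal. -/
lemma hInd_char_odd (ρ : TwistedRep (1 : π.ker →* ℤˣ) (α.res le_rfl) W) (hς : π ς = -1)
    {g ω : Γ} (h : π ω = -1) : (ρ.hInd hς).char g ω = 0 := by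
  rw [char, dif_neg (by rintro ⟨-, h', -⟩; rw [h] at h'; exact absurd h' (by decide))]
  split_ifs with h'
  swap; · rfl
  obtain ⟨hg, hω, m⟩ := h'
  let P : (ρ.hInd hς).Tr (g := g) hg →ₗ[k] (ρ.hInd hς).Tr (g := g) hg :=
    Linear.leftComp k _ fstProj
  let β := (ρ.hInd hς).betaOdd hg hω hg m
  have P₁ : ∀ φ X, ((P φ).app X).1 = (φ.app X).1 := fun φ X =>
    (rfl : _ = 𝟙 _ ≫ (φ.app X).1).trans (Category.id_comp _)
  have P₂ : ∀ φ X, ((P φ).app X).2 = 0 := fun φ X =>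
    (rfl : _ = 0 ≫ (φ.app X).2).trans Limits.zero_comp
  have Q₁ : ∀ φ X, (((1 - P) φ).app X).1 = 0 := fun φ X =>
    (rfl : _ = (φ.app X).1 - ((P φ).app X).1).trans (by rw [P₁, sub_self])
  have Q₂ : ∀ φ X, (((1 - P) φ).app X).2 = (φ.app X).2 := fun φ X =>
    (rfl : _ = (φ.app X).2 - ((P φ).app X).2).trans (by rw [P₂, sub_zero])
  have hP : P * P = P := LinearMap.ext fun φ => NatTrans.ext <| funext fun X =>
    Prod.ext (P₁ _ _) ((P₂ _ _).trans (P₂ _ _).symm)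
  have h₁ : P * β * P = 0 := LinearMap.ext fun φ => NatTrans.ext <| funext fun X =>
    Prod.ext ((P₁ _ _).trans (ρ.hInd_betaOdd_fst hς hg hω hg m _ (P₂ φ) X)) (P₂ _ _)
  have h₂ : (1 - P) * β * (1 - P) = 0 := LinearMap.ext fun φ => NatTrans.ext <| funext fun X =>
    Prod.ext (Q₁ _ _) ((Q₂ _ _).trans (ρ.hInd_betaOdd_snd hς hg hω hg m _ (Q₁ φ) X))
  -- Idempotency lets each projection be written twice, so that cyclicity of the trace turns the two
  -- terms into `P β P` and `(1 - P) β (1 - P)`.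
  have e : β = β * P * P + β * (1 - P) * (1 - P) := by
    have : (1 - P) * (1 - P) = 1 - P := by simp [mul_sub, sub_mul, hP]
    rw [mul_assoc, mul_assoc, hP, this]
    simp [mul_sub]
  change LinearMap.trace k _ β = 0
  rw [e, map_add, LinearMap.trace_mul_comm, LinearMap.trace_mul_comm k (β * (1 - P)), ← mul_assoc,
    ← mul_assoc, h₁, h₂, map_zero, add_zero]

end TwistedRep

/-! ### Traces on products and comparison of coordinates. -/

lemma trace_pi_eq_sum {k ι : Type*} [Field k] [Fintype ι] [DecidableEq ι] {N : ι → Type*}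
    [∀ i, AddCommGroup (N i)] [∀ i, Module k (N i)] [∀ i, Module.Finite k (N i)]
    (f : (∀ i, N i) →ₗ[k] ∀ i, N i) :
    LinearMap.trace k _ f =
      ∑ i, LinearMap.trace k (N i) (LinearMap.proj i ∘ₗ f ∘ₗ LinearMap.single k N i) := by
  have h : f = ∑ i, (f ∘ₗ LinearMap.single k N i) ∘ₗ LinearMap.proj i := by
    refine LinearMap.ext fun x => ?_
    rw [LinearMap.sum_apply]
    simp only [LinearMap.comp_apply, LinearMap.proj_apply, LinearMap.single_apply]
    rw [← map_sum, Finset.univ_sum_single]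
  conv_lhs => rw [h, map_sum]
  exact Finset.sum_congr rfl fun i _ => LinearMap.trace_comp_comm' _ _

section IdxHom

variable {V : Type u} [Category.{v} V] [Preadditive V] {ι : Type*}

open Classical in
/-- The morphism `x i ⟶ x i'` which is the identity if `i = i'` and zero otherwise. -/
noncomputable def idxHom (x : ι → V) (i i' : ι) : x i ⟶ x i' :=
  if h : i = i' then eqToHom (congrArg x h) else 0

@[simp] lemma idxHom_self (x : ι → V) (i : ι) : idxHom x i i = 𝟙 (x i) := by
  simp [idxHom]

lemma idxHom_of_ne (x : ι → V) {i i' : ι} (h : i ≠ i') : idxHom x i i' = 0 := by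
  simp [idxHom, h]

lemma idxHom_nat {x y : ι → V} (f : x ⟶ y) (i i' : ι) :
    f i ≫ idxHom y i i' = idxHom x i i' ≫ f i' := by
  by_cases h : i = i'
  · subst h; simp
  · simp [idxHom_of_ne _ h]

end IdxHom

/-! ### Characters of representations induced from `H`. -/

namespace TwistedRep

variable {k : Type*} [Field k] {Γ : Type*} [Group Γ] {π : Γ →* ℤˣ}
  {α : TwistedCocycle k π} {H : Subgroup Γ} {hH : H ≤ π.ker} {ι : Type*}
  {V : Type u} [Category.{v} V] [Preadditive V] [Linear k V]

/-- The transformation `1 ⟹ Ind(ρ)(g)` assembled from a family of transformations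
`1 ⟹ ρ(hⱼ)`, of which only those at the fixed points `j` of `g` contribute. -/
noncomputable def indTr (ρ : TwistedRep 1 (α.res hH) V) (R : CosetReps π H ι) (g : π.ker) :
    (∀ j, 𝟭 V ⟶ ρ.fn (R.coef g j)) →ₗ[k] (𝟭 (ι → V) ⟶ (ρ.ind R).fn g) where
  toFun θ :=
    { app := fun x j => (θ j).app (x j) ≫ (ρ.fn (R.coef g j)).map (idxHom x j (R.idx g j))
      naturality := fun _ _ f => funext fun j =>
        square_comp ((θ j).naturality (f j)) (square_map _ (idxHom_nat f j (R.idx g j))) }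
  map_add' _ _ := NatTrans.ext <| funext fun _ => funext fun _ => Preadditive.add_comp _ _ _ _ _ _
  map_smul' _ _ := NatTrans.ext <| funext fun _ => funext fun _ => Linear.smul_comp _ _ _ _ _ _

/-- The components at constant families of a transformation `1 ⟹ Ind(ρ)(g)`. -/
noncomputable def trInd (ρ : TwistedRep 1 (α.res hH) V) (R : CosetReps π H ι) (g : π.ker) :
    (𝟭 (ι → V) ⟶ (ρ.ind R).fn g) →ₗ[k] (∀ j, 𝟭 V ⟶ ρ.fn (R.coef g j)) where
  toFun Φ j :=
    { app := fun v => Φ.app (fun _ => v) j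
      naturality := fun v v' f =>
        congrFun (Φ.naturality (X := fun _ => v) (Y := fun _ => v') (fun _ => f)) j }
  map_add' _ _ := rfl
  map_smul' _ _ := rfl

/-- Naturality is applied to the morphism from the constant family at `x j` to `x` that is the
identity at `j` and zero elsewhere. In particular the component at `j` vanishes unless `g` fixes the
coset of `j`. -/
lemma app_eq_trInd (ρ : TwistedRep 1 (α.res hH) V) (R : CosetReps π H ι) {g : π.ker}
    (Φ : 𝟭 (ι → V) ⟶ (ρ.ind R).fn g) (x : ι → V) (j : ι) :
    Φ.app x j = (ρ.trInd R g Φ j).app (x j) ≫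
      (ρ.fn (R.coef g j)).map (idxHom x j (R.idx g j)) := by
  have h := congrFun (Φ.naturality (X := fun _ => x j) (Y := x) (fun i => idxHom x j i)) j
  refine Eq.trans ?_ h
  exact ((congrArg (· ≫ Φ.app x j) (idxHom_self x j)).trans (Category.id_comp _)).symm

lemma indTr_trInd (ρ : TwistedRep 1 (α.res hH) V) (R : CosetReps π H ι) {g : π.ker}
    (Φ : 𝟭 (ι → V) ⟶ (ρ.ind R).fn g) : ρ.indTr R g (ρ.trInd R g Φ) = Φ :=
  NatTrans.ext <| funext fun x => funext fun j => (ρ.app_eq_trInd R Φ x j).symm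

lemma ind_tr_finite [Finite ι] (ρ : TwistedRep 1 (α.res hH) V) (R : CosetReps π H ι)
    (hfin : ∀ h, Module.Finite k (𝟭 V ⟶ ρ.fn h)) (g : π.ker) :
    Module.Finite k (𝟭 (ι → V) ⟶ (ρ.ind R).fn g) :=
  Module.Finite.of_surjective (ρ.indTr R g) fun Φ => ⟨_, ρ.indTr_trInd R Φ⟩

lemma mulIsoIdx_const (ρ : TwistedRep 1 (α.res hH) V) {h₂ h₁ h : H} (m : h₂ * h₁ = h) (v : V)
    {i i' : ι} (e : i = i') : ρ.mulIsoIdx m (fun _ : ι => v) e = ρ.mulIso m v := by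
  ext
  simp [mulIsoIdx]

/-- This is component `j` of the defining square of conjugation at a constant family. The family
`ρ(hᵢ)v` is no longer constant, hence the factor `idxHom`. -/
lemma ind_conj_app (ρ : TwistedRep 1 (α.res hH) V) (R : CosetReps π H ι) {g ω : π.ker}
    (e : g * ω = ω * g) (Θ : 𝟭 (ι → V) ⟶ (ρ.ind R).fn g) (j : ι) (v : V) :
    ((ρ.trInd R g ((ρ.ind R).conj e Θ) j).app ((ρ.fn (R.coef ω j)).obj v) ≫
      (ρ.fn (R.coef g j)).map (idxHom (fun i => (ρ.fn (R.coef ω i)).obj v) j (R.idx g j))) ≫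
        (scaleIso (indCoeff α R g ω j) (ρ.mulIso (R.coef_mul e j) v)).hom =
    (ρ.fn (R.coef ω j)).map ((ρ.trInd R g Θ (R.idx ω j)).app v) ≫
        (scaleIso (indCoeff α R ω g j) (ρ.mulIso (R.coef_mul rfl j) v)).hom := by
  have h := congrFun ((ρ.ind R).conj_app e rfl Θ (fun _ => v)) j
  rw [← ρ.mulIsoIdx_const (R.coef_mul e j) v (R.idx_mul e j),
    ← ρ.mulIsoIdx_const (R.coef_mul rfl j) v (R.idx_mul rfl j)]
  refine Eq.trans ?_ h
  exact congrArg (· ≫ _) (ρ.app_eq_trInd R ((ρ.ind R).conj e Θ)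
    (fun i => (ρ.fn (R.coef ω i)).obj v) j).symm

lemma map_idxHom_mulIso (ρ : TwistedRep 1 (α.res hH) V) {h n : H} (w : ι → H) {i j : ι}
    (e : i = j) (m : h * w i = n) (m' : h * w j = n) (c : kˣ) (v : V) :
    (ρ.fn h).map (idxHom (fun i => (ρ.fn (w i)).obj v) j i) ≫ (scaleIso c (ρ.mulIso m v)).hom =
      (scaleIso c (ρ.mulIso m' v)).hom := by
  subst e
  simp

lemma map_app_mulIso_congr (ρ : TwistedRep 1 (α.res hH) V) {w n : H} (h : ι → H)
    (θ : ∀ i, 𝟭 V ⟶ ρ.fn (h i)) {i j : ι} (e : i = j) (m : w * h i = n) (m' : w * h j = n) (c : kˣ)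
    (v : V) :
    (ρ.fn w).map ((θ i).app v) ≫ (scaleIso c (ρ.mulIso m v)).hom =
      (ρ.fn w).map ((θ j).app v) ≫ (scaleIso c (ρ.mulIso m' v)).hom := by
  subst e
  rfl

/-- The diagonal blocks of conjugation by `ω` on the categorical trace of an induced
representation. -/
noncomputable def indBlock [DecidableEq ι] (ρ : TwistedRep 1 (α.res hH) V) (R : CosetReps π H ι)
    {g ω : π.ker} (e : g * ω = ω * g) (j : ι) :
    (𝟭 V ⟶ ρ.fn (R.coef g j)) →ₗ[k] (𝟭 V ⟶ ρ.fn (R.coef g j)) :=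
  LinearMap.proj j ∘ₗ (ρ.trInd R g ∘ₗ (ρ.ind R).conj e ∘ₗ ρ.indTr R g) ∘ₗ
    LinearMap.single k (fun i => 𝟭 V ⟶ ρ.fn (R.coef g i)) j

lemma trInd_indTr_single [DecidableEq ι] (ρ : TwistedRep 1 (α.res hH) V) (R : CosetReps π H ι)
    {g : π.ker} {i j : ι} (hi : R.idx g j ≠ j ∨ i ≠ j) (θ : 𝟭 V ⟶ ρ.fn (R.coef g j)) :
    ρ.trInd R g (ρ.indTr R g (Pi.single j θ)) i = 0 := by
  ext v
  change (Pi.single (M := fun i => 𝟭 V ⟶ ρ.fn (R.coef g i)) j θ i).app v ≫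
    (ρ.fn (R.coef g i)).map (idxHom (fun _ => v) i (R.idx g i)) = 0
  by_cases h : i = j
  · subst h
    rw [idxHom_of_ne _ (hi.resolve_right (by simp)).symm]
    simp
  · rw [Pi.single_eq_of_ne h]
    simp

lemma indTr_single_of_ne [DecidableEq ι] (ρ : TwistedRep 1 (α.res hH) V) (R : CosetReps π H ι)
    {g : π.ker} {j : ι} (hj : R.idx g j ≠ j) (θ : 𝟭 V ⟶ ρ.fn (R.coef g j)) :
    ρ.indTr R g (Pi.single j θ) = 0 := by
  rw [← ρ.indTr_trInd R (ρ.indTr R g (Pi.single j θ)),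
    funext fun i => ρ.trInd_indTr_single R (Or.inl hj) (i := i) θ]
  exact map_zero _

lemma trInd_indTr_single_self [DecidableEq ι] (ρ : TwistedRep 1 (α.res hH) V)
    (R : CosetReps π H ι) {g : π.ker} {j : ι} (hj : R.idx g j = j)
    (θ : 𝟭 V ⟶ ρ.fn (R.coef g j)) :
    ρ.trInd R g (ρ.indTr R g (Pi.single j θ)) j = θ := by
  ext v
  change (Pi.single (M := fun i => 𝟭 V ⟶ ρ.fn (R.coef g i)) j θ j).app v ≫
    (ρ.fn (R.coef g j)).map (idxHom (fun _ => v) j (R.idx g j)) = _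
  rw [Pi.single_eq_same, hj, idxHom_self]
  simp

/-- If `g` moves the coset of `j`, a family supported at `j` induces the zero transformation. If
only `ω` moves it, component `j` of the conjugate is computed from the component at `idx ω j ≠ j`,
where the family is zero. -/
lemma indBlock_of_ne [DecidableEq ι] (ρ : TwistedRep 1 (α.res hH) V) (R : CosetReps π H ι)
    {g ω : π.ker} (e : g * ω = ω * g) {j : ι} (hj : ¬(R.idx g j = j ∧ R.idx ω j = j)) :
    ρ.indBlock R e j = 0 := by
  ext1 θ
  by_cases hg : R.idx g j = j
  · have hω : R.idx ω j ≠ j := fun h => hj ⟨hg, h⟩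
    refine ρ.tr_ext (R.coef ω j) fun v => ?_
    have h := ρ.ind_conj_app R e (ρ.indTr R g (Pi.single j θ)) j v
    rw [ρ.trInd_indTr_single R (Or.inr hω), Category.assoc,
      ρ.map_idxHom_mulIso (R.coef ω) hg _ (by simpa only [hg] using R.coef_mul e j)] at h
    simp only [NatTrans.app_zero, Functor.map_zero, Limits.zero_comp] at h
    exact (cancel_mono _).1 (h.trans Limits.zero_comp.symm)
  · change ρ.trInd R g ((ρ.ind R).conj e (ρ.indTr R g (Pi.single j θ))) j = 0
    rw [ρ.indTr_single_of_ne R hg, map_zero, map_zero]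
    rfl

lemma indBlock_of_eq [DecidableEq ι] (ρ : TwistedRep 1 (α.res hH) V) (R : CosetReps π H ι)
    {g ω : π.ker} (e : g * ω = ω * g) {j : ι} (hg : R.idx g j = j) (hω : R.idx ω j = j)
    (m : R.coef g j * R.coef ω j = R.coef ω j * R.coef g j) :
    ρ.indBlock R e j =
      ((indCoeff α R ω g j / indCoeff α R g ω j : kˣ) : k) • ρ.conj m := by
  ext1 θ
  have m₂ : R.coef ω j * R.coef g j = R.coef (ω * g) j := by
    simpa only [hω] using R.coef_mul (rfl : ω * g = _) j
  have key : ρ.conj m θ =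
      ((indCoeff α R g ω j / indCoeff α R ω g j : kˣ) : k) • ρ.indBlock R e j θ := by
    refine ρ.conj_eq (m.trans m₂) m₂ fun v => ?_
    have h := ρ.ind_conj_app R e (ρ.indTr R g (Pi.single j θ)) j v
    rw [Category.assoc, ρ.map_idxHom_mulIso (R.coef ω) hg _ (m.trans m₂),
      ρ.map_app_mulIso_congr (R.coef g) _ hω _ m₂, trInd_indTr_single_self _ _ hg] at h
    simp only [scaleIso_hom, Linear.comp_smul] at h
    rw [NatTrans.app_smul, Linear.smul_comp, div_eq_inv_mul, Units.val_mul, mul_smul]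
    refine Eq.trans (congrArg _ h) ?_
    rw [smul_smul]
    simp
  rw [LinearMap.smul_apply, key, smul_smul, ← Units.val_mul]
  simp

lemma ind_char [Fintype ι] [DecidableEq ι] (ρ : TwistedRep 1 (α.res hH) V) (R : CosetReps π H ι)
    (hfin : ∀ h, Module.Finite k (𝟭 V ⟶ ρ.fn h)) {g ω : π.ker} (e : g * ω = ω * g) :
    (ρ.ind R).char g ω = ∑ j, if R.idx g j = j ∧ R.idx ω j = j then
      ((indCoeff α R ω g j / indCoeff α R g ω j : kˣ) : k) * ρ.char (R.coef g j) (R.coef ω j)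
      else 0 := by
  have := ρ.ind_tr_finite R hfin g
  -- Since `indTr` after `trInd` is the identity, cyclicity moves the trace to the product over all
  -- cosets. The cosets not fixed by `g` need not be discarded beforehand, as their blocks vanish.
  have h : (ρ.ind R).conj e = ((ρ.ind R).conj e ∘ₗ ρ.indTr R g) ∘ₗ ρ.trInd R g :=
    LinearMap.ext fun Φ => congrArg _ (ρ.indTr_trInd R Φ).symm
  rw [char_of_commute _ e, h, LinearMap.trace_comp_comm', trace_pi_eq_sum]
  refine Finset.sum_congr rfl fun j _ => ?_
  change LinearMap.trace k _ (ρ.indBlock R e j) = _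
  split_ifs with hj
  · have m : R.coef g j * R.coef ω j = R.coef ω j * R.coef g j := by
      have h₁ := R.coef_mul e j
      have h₂ := R.coef_mul (rfl : ω * g = _) j
      rw [hj.1] at h₁
      rw [hj.2] at h₂
      rw [h₁, h₂]
    rw [ρ.indBlock_of_eq R e hj.1 hj.2 m, map_smul, char_of_commute _ m, smul_eq_mul]
  · rw [ρ.indBlock_of_ne R e hj, map_zero]

end TwistedRep

/-! ### From coset representatives to the sum over the whole group. -/

variable {k : Type*} [Field k] {Γ : Type*} [Group Γ] {π : Γ →* ℤˣ}

lemma realConj_of_even {σ : Γ} (h : π σ = 1) (g : Γ) : realConj π σ g = σ * g * σ⁻¹ := by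
  simp [realConj, h]

lemma realConj_mul_of_even {x : Γ} (h : π x = 1) (σ g : Γ) :
    realConj π (x * σ) g = x * realConj π σ g * x⁻¹ := by
  simp [realConj, h, mul_assoc]

lemma TwistedCocycle.transgress₂_of_even (α : TwistedCocycle k π) {x g ω g₁ ω₁ : Γ} (hx : π x = 1)
    (hω : π ω = 1) (e : g * ω = ω * g) (e₁ : g₁ * x = x * g) (e₂ : ω₁ * x = x * ω) :
    α.transgress₂ x g ω = α.shuffle ω₁ x g₁ g₁ g / α.shuffle x ω g₁ g g := by
  have hg₁ : g₁ = x * g * x⁻¹ := by rw [← e₁, mul_inv_cancel_right]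
  have hω₁ : ω₁ = x * ω * x⁻¹ := by rw [← e₂, mul_inv_cancel_right]
  have e₃ : g₁ * ω₁ = ω₁ * g₁ := by
    simp only [hg₁, hω₁, mul_assoc, inv_mul_cancel_left]
    rw [← mul_assoc g, e, mul_assoc]
  rw [transgress₂, ← hω₁, α.transgress_of_even (by simp [hω₁, hω]) (by simp [hx]) e₁ e₃,
    α.transgress_of_even hx (by simp [hω]) e e₁]

lemma commute_realConj {σ g ω : Γ} (e : g * ω = ω * g) :
    realConj π σ g * (σ * ω * σ⁻¹) = σ * ω * σ⁻¹ * realConj π σ g := by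
  have h : g ^ ((π σ : ℤˣ) : ℤ) * ω = ω * g ^ ((π σ : ℤˣ) : ℤ) :=
    Commute.zpow_left (show Commute g ω from e) _
  simp only [realConj, mul_assoc, inv_mul_cancel_left]
  rw [← mul_assoc (g ^ _), h, mul_assoc]

namespace CosetReps

variable {H : Subgroup Γ} {ι : Type*} (R : CosetReps π H ι)

lemma idx_eq_self_iff (g : π.ker) (j : ι) :
    R.idx g j = j ↔ (R.rep j : Γ)⁻¹ * g * R.rep j ∈ H := by
  refine ⟨fun h => ?_, R.idx_unique⟩
  have := (R.coef g j).2
  simpa only [coef, h] using this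

lemma coef_of_idx_eq_self {g : π.ker} {j : ι} (h : R.idx g j = j) :
    (R.coef g j : Γ) = (R.rep j : Γ)⁻¹ * g * R.rep j := by
  simp only [coef, h]

lemma eq_of_rep_inv_mul_mem {i j : ι} (h : (R.rep j : Γ)⁻¹ * R.rep i ∈ H) : i = j :=
  (R.existsUnique (R.rep i)).unique (by simp) h

lemma finite [Finite Γ] {ι : Type*} (R : CosetReps π H ι) : Finite ι :=
  Finite.of_injective R.rep fun i j h => R.eq_of_rep_inv_mul_mem (by simp [h])

/-- The representatives `rⱼ⁻¹` and `rⱼ⁻¹ ς⁻¹` of `H \ Γ`. -/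
def repInv (ς : Γ) : ι ⊕ ι → Γ
  | .inl j => (R.rep j : Γ)⁻¹
  | .inr j => (R.rep j : Γ)⁻¹ * ς⁻¹

/-- The degree separates the two families of representatives. Right multiplication by `ς` moves the
odd half to the even half, where the decomposition of `G` into cosets of `H` applies after
inversion. -/
lemma mul_repInv_bijective (hH : H ≤ π.ker) {ς : Γ} (hς : π ς = -1) :
    Function.Bijective fun p : H × (ι ⊕ ι) => (p.1 : Γ) * R.repInv ς p.2 := by
  have hπ : ∀ j, π (R.rep j : Γ) = 1 := fun j => (R.rep j).2
  have hπH : ∀ h : H, π (h : Γ) = 1 := fun h => hH h.2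
  have key : ∀ (h h' : H) (i j : ι), (h : Γ) * (R.rep i : Γ)⁻¹ = h' * (R.rep j : Γ)⁻¹ →
      h = h' ∧ i = j := fun h h' i j e => by
    have e' : i = j := by
      apply R.eq_of_rep_inv_mul_mem
      have : (R.rep j : Γ)⁻¹ * R.rep i = (h' : Γ)⁻¹ * h := by
        rw [← mul_right_inj (h' : Γ), ← mul_assoc, ← e]
        simp
      rw [this]
      exact H.mul_mem (H.inv_mem h'.2) h.2
    subst e'
    exact ⟨Subtype.ext (mul_right_cancel e), rfl⟩
  constructor
  · rintro ⟨h, i | i⟩ ⟨h', j | j⟩ e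
    · obtain ⟨rfl, rfl⟩ := key h h' i j e
      rfl
    · have := congrArg π e
      simp [repInv, hπ, hπH, hς] at this
    · have := congrArg π e
      simp [repInv, hπ, hπH, hς] at this
    · obtain ⟨rfl, rfl⟩ := key h h' i j (by
        simp only [repInv, ← mul_assoc] at e
        exact mul_right_cancel e)
      rfl
  · intro γ
    have ex : ∀ γ : Γ, π γ = 1 → ∃ (h : H) (j : ι), (h : Γ) * (R.rep j : Γ)⁻¹ = γ := fun γ hγ => by
      obtain ⟨j, hj, -⟩ := R.existsUnique (⟨γ, hγ⟩ : π.ker)⁻¹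
      exact ⟨⟨_, H.inv_mem hj⟩, j, by simp⟩
    rcases Int.units_eq_one_or (π γ) with hγ | hγ
    · obtain ⟨h, j, e⟩ := ex γ hγ
      exact ⟨(h, .inl j), e⟩
    · obtain ⟨h, j, e⟩ := ex (γ * ς) (by simp [hγ, hς])
      refine ⟨(h, .inr j), ?_⟩
      simp only [repInv, ← mul_assoc, e]
      simp

end CosetReps

namespace TwistedRep

variable {α : TwistedCocycle k π} {H : Subgroup Γ} {hH : H ≤ π.ker} {ι : Type*}
  {V : Type u} [Category.{v} V] [Preadditive V] [Linear k V]

open Classical in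
/-- The 2-character of a representation of `H`, extended by zero to `Γ`. -/
noncomputable def charExt (ρ : TwistedRep 1 (α.res hH) V) (g ω : Γ) : k :=
  if h : g ∈ H ∧ ω ∈ H then ρ.char ⟨g, h.1⟩ ⟨ω, h.2⟩ else 0

lemma charExt_conj (ρ : TwistedRep 1 (α.res hH) V) {g ω : Γ} (e : g * ω = ω * g) (h : H) :
    ρ.charExt (h * g * (h : Γ)⁻¹) (h * ω * (h : Γ)⁻¹) =
      (α.transgress₂ h g ω : k) * ρ.charExt g ω := by
  have iff : ∀ x : Γ, h * x * (h : Γ)⁻¹ ∈ H ↔ x ∈ H := fun x => by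
    rw [H.mul_mem_cancel_right (H.inv_mem h.2), H.mul_mem_cancel_left h.2]
  by_cases hm : g ∈ H ∧ ω ∈ H
  · rw [charExt, charExt, dif_pos hm, dif_pos ⟨(iff g).2 hm.1, (iff ω).2 hm.2⟩,
      α.transgress₂_of_even (g₁ := h * g * (h : Γ)⁻¹) (ω₁ := h * ω * (h : Γ)⁻¹) (hH h.2) (hH hm.2) e
        (by simp) (by simp)]
    exact ρ.char_conj (g := ⟨g, hm.1⟩) (ω := ⟨ω, hm.2⟩) (h := h) (Subtype.ext e)
      (Subtype.ext (by simp)) (Subtype.ext (by simp))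
  · rw [charExt, charExt, dif_neg hm, dif_neg (by rwa [iff, iff]), mul_zero]

/-- The contribution of `σ` to the character of the hyperbolically induced representation. -/
noncomputable def charTerm (ρ : TwistedRep 1 (α.res hH) V) (g ω σ : Γ) : k :=
  (((α.transgress₂ σ g ω)⁻¹ : kˣ) : k) * ρ.charExt (realConj π σ g) (σ * ω * σ⁻¹)

/-- The factor at `h` in the multiplicative double transgression cancels the factor by which the
character of `ρ` changes under conjugation by `h`. -/
lemma charTerm_mul (ρ : TwistedRep 1 (α.res hH) V) {g ω : Γ} (hg : π g = 1) (hω : π ω = 1)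
    (e : g * ω = ω * g) (h : H) (σ : Γ) : ρ.charTerm g ω (h * σ) = ρ.charTerm g ω σ := by
  have hh : π (h : Γ) = 1 := hH h.2
  have e' : (h : Γ) * σ * ω * ((h : Γ) * σ)⁻¹ = h * (σ * ω * σ⁻¹) * (h : Γ)⁻¹ := by
    simp [mul_assoc]
  rw [charTerm, charTerm, realConj_mul_of_even hh, e', ρ.charExt_conj (commute_realConj e),
    α.transgress₂_mul hh hg hω e, mul_inv_rev, ← mul_assoc, ← Units.val_mul, inv_mul_cancel_right]

/-- A coset is fixed by `g` and `ω` exactly when `rⱼ⁻¹ g rⱼ` and `rⱼ⁻¹ ω rⱼ` lie in `H`, so the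
extension by zero in `charExt` matches the condition in `ind_char`, and `transgress₂_inv` matches
the scalars. -/
lemma ind_char_eq_sum_charTerm [Fintype ι] (ρ : TwistedRep 1 (α.res hH) V) (R : CosetReps π H ι)
    (hfin : ∀ h, Module.Finite k (𝟭 V ⟶ ρ.fn h)) {g ω : π.ker} (e : g * ω = ω * g) :
    (ρ.ind R).char g ω = ∑ j, ρ.charTerm g ω (R.rep j : Γ)⁻¹ := by
  classical
  rw [ρ.ind_char R hfin e]
  refine Finset.sum_congr rfl fun j _ => ?_
  have hr : π (R.rep j : Γ)⁻¹ = 1 := by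
    rw [map_inv, show π (R.rep j) = 1 from (R.rep j).2, inv_one]
  rw [charTerm, realConj_of_even hr, inv_inv]
  by_cases hj : R.idx g j = j ∧ R.idx ω j = j
  · have hm := And.intro ((R.idx_eq_self_iff g j).1 hj.1) ((R.idx_eq_self_iff ω j).1 hj.2)
    have e₁ := R.rep_mul_coef g j
    have e₂ := R.rep_mul_coef ω j
    rw [hj.1] at e₁
    rw [hj.2] at e₂
    rw [if_pos hj, charExt, dif_pos hm, α.transgress₂_inv (R.rep j).2 g.2 ω.2
      (congrArg Subtype.val e) e₁ e₂]
    congr 2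
    · simp only [indCoeff, hj.1, hj.2]
    · exact Subtype.ext (R.coef_of_idx_eq_self hj.1)
    · exact Subtype.ext (R.coef_of_idx_eq_self hj.2)
  · rw [if_neg hj, charExt, dif_neg (by rwa [← R.idx_eq_self_iff, ← R.idx_eq_self_iff]), mul_zero]

lemma hInd_ind_char [Fintype ι] (ρ : TwistedRep 1 (α.res hH) V) (R : CosetReps π H ι) {ς : Γ}
    (hς : π ς = -1) (hfin : ∀ h, Module.Finite k (𝟭 V ⟶ ρ.fn h)) {g ω : Γ} (hg : π g = 1)
    (hω : π ω = 1) (e : g * ω = ω * g) :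
    ((ρ.ind R).hInd hς).char g ω = ∑ q, ρ.charTerm g ω (R.repInv ς q) := by
  let g' : π.ker := ⟨g, hg⟩
  let ω' : π.ker := ⟨ω, hω⟩
  let b : π.ker := (conjElt hς g'.2)⁻¹
  let c : π.ker := conjElt hς ω'.2
  have hb : (b : Γ) = realConj π ς⁻¹ g := by
    simp [b, conjElt, realConj, hς, mul_assoc, g']
  have hc : (c : Γ) = ς⁻¹ * ω * ς⁻¹⁻¹ := by simp [c, conjElt, ω']
  have e' : b * c = c * b := by
    apply Subtype.ext
    rw [Subgroup.coe_mul, Subgroup.coe_mul, hb, hc, commute_realConj e]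
  have hm : conjElt hς g'.2 * b = 1 := mul_inv_cancel _
  -- The scalar on the second summand is the inverse double transgression at `ς⁻¹`. Multiplicativity
  -- then merges it with the one at `rⱼ⁻¹` into the value at `rⱼ⁻¹ς⁻¹`.
  have S := α.transgress₂_inv_odd (a := conjElt hς g'.2) (b := b) (w := c) hς hg hω e
    (by simp [conjElt, g', mul_assoc]) (by simp [conjElt, c, ω', mul_assoc])
    (congrArg Subtype.val hm)
  rw [(ρ.ind R).hInd_char_even hς (ρ.ind_tr_finite R hfin) (g := g') (ω := ω') hm rfl
      (Subtype.ext e) e', ← S, ρ.ind_char_eq_sum_charTerm R hfin (Subtype.ext e),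
    ρ.ind_char_eq_sum_charTerm R hfin e', Fintype.sum_sum_type, Finset.mul_sum]
  congr 1
  refine Finset.sum_congr rfl fun j _ => ?_
  have hr : π (R.rep j : Γ)⁻¹ = 1 := by
    rw [map_inv, show π (R.rep j) = 1 from (R.rep j).2, inv_one]
  have e₁ : (R.rep j : Γ)⁻¹ * ς⁻¹ * ω * ((R.rep j : Γ)⁻¹ * ς⁻¹)⁻¹ =
      (R.rep j : Γ)⁻¹ * (ς⁻¹ * ω * ς⁻¹⁻¹) * (R.rep j : Γ)⁻¹⁻¹ := by
    simp [mul_assoc]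
  rw [charTerm, charTerm, CosetReps.repInv, realConj_mul_of_even hr, realConj_of_even hr,
    α.transgress₂_mul hr hg hω e, hb, hc, e₁, mul_inv_rev, Units.val_mul,
    mul_assoc (Units.val _)]

lemma sum_charTerm [Fintype Γ] [Fintype ι] (ρ : TwistedRep 1 (α.res hH) V) (R : CosetReps π H ι)
    {ς : Γ} (hς : π ς = -1) {g ω : Γ} (hg : π g = 1) (hω : π ω = 1) (e : g * ω = ω * g) :
    ∑ σ, ρ.charTerm g ω σ = (Nat.card H : k) * ∑ q, ρ.charTerm g ω (R.repInv ς q) := by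
  classical
  rw [← (R.mul_repInv_bijective hH hς).sum_comp, Fintype.sum_prod_type]
  simp only [ρ.charTerm_mul hg hω e]
  rw [Finset.sum_const, Finset.card_univ, nsmul_eq_mul, Nat.card_eq_fintype_card]

lemma sum_subtype_eq_sum_charTerm [Fintype Γ] [DecidablePred (· ∈ H)]
    (ρ : TwistedRep 1 (α.res hH) V) (g ω : Γ) :
    ∑ σ : {σ : Γ // realConj π σ g ∈ H ∧ σ * ω * σ⁻¹ ∈ H},
      (((α.transgress₂ σ g ω)⁻¹ : kˣ) : k) *
        ρ.char ⟨realConj π σ g, σ.2.1⟩ ⟨σ * ω * (σ : Γ)⁻¹, σ.2.2⟩ =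
    ∑ σ, ρ.charTerm g ω σ := by
  have h := Finset.sum_subtype (F := Subtype.fintype _) (Finset.univ.filter fun σ : Γ =>
    realConj π σ g ∈ H ∧ σ * ω * σ⁻¹ ∈ H) (fun _ => Finset.mem_filter_univ _) (ρ.charTerm g ω)
  rw [Finset.sum_filter_of_ne] at h
  · rw [h]
    refine Finset.sum_congr rfl fun σ _ => ?_
    rw [charTerm, charExt, dif_pos σ.2]
  · intro σ _ hσ
    by_contra hn
    exact hσ (by rw [charTerm, charExt, dif_neg hn, mul_zero])

end TwistedRep

end RealTwoRep

theorem mainTheorem5 {k : Type*} [Field k] {Γ : Type*} [Group Γ] [Fintype Γ] (π : Γ →* ℤˣ)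
    (α : RealTwoRep.TwistedCocycle k π) (H : Subgroup Γ) [DecidablePred (· ∈ H)]
    (hH : H ≤ π.ker) {V : Type u} [Category.{v} V] [Preadditive V] [Linear k V]
    (ρ : RealTwoRep.TwistedRep (1 : H →* ℤˣ) (α.res hH) V)
    (hfin : ∀ h : H, Module.Finite k (ρ.Tr (g := h) rfl))
    {ι : Type w} (R : RealTwoRep.CosetReps π H ι) {ς : Γ} (hς : π ς = -1) :
    (∀ (g : Γ) (hg : π g = 1), Module.Finite k (((ρ.ind R).hInd hς).Tr (g := g) hg)) ∧
    ((Nat.card H : k) ≠ 0 → ∀ g ω : Γ, RealTwoRep.GradedCommute π g ω →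
      ((ρ.ind R).hInd hς).char g ω =
        (1 / (Nat.card H : k)) *
          ∑ σ : {σ : Γ // RealTwoRep.realConj π σ g ∈ H ∧ σ * ω * σ⁻¹ ∈ H},
            (((α.transgress₂ σ g ω)⁻¹ : kˣ) : k) *
              ρ.char ⟨RealTwoRep.realConj π σ g, σ.2.1⟩ ⟨σ * ω * (σ : Γ)⁻¹, σ.2.2⟩) ∧
    (∀ g ω : Γ, RealTwoRep.GradedCommute π g ω →
      ((ρ.ind R).hInd hς).char g ω ≠ 0 → ω ∈ π.ker) := by
  have := R.finite
  have := Fintype.ofFinite ι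
  have hfin' : ∀ h, Module.Finite k (𝟭 V ⟶ ρ.fn h) := hfin
  refine ⟨fun g hg => (ρ.ind R).hInd_tr_finite hς (ρ.ind_tr_finite R hfin') ⟨g, hg⟩,
    fun hcard g ω hgω => ?_, fun g ω _ hχ => ?_⟩
  · rw [ρ.sum_subtype_eq_sum_charTerm]
    obtain ⟨hg, e⟩ := hgω
    rcases Int.units_eq_one_or (π ω) with hω | hω
    · have e' : g * ω = ω * g := by simpa [hω] using e.symm
      rw [ρ.hInd_ind_char R hς hfin' hg hω e', ρ.sum_charTerm R hς hg hω e', one_div,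
        inv_mul_cancel_left₀ hcard]
    -- For odd `ω` both sides are zero: a conjugate of `ω` in `H` would have degree `1`.
    · rw [(ρ.ind R).hInd_char_odd hς hω, Finset.sum_eq_zero, mul_zero]
      intro σ _
      rw [RealTwoRep.TwistedRep.charTerm, RealTwoRep.TwistedRep.charExt, dif_neg, mul_zero]
      rintro ⟨-, h⟩
      have h' : π (σ * ω * σ⁻¹) = 1 := hH h
      rw [map_mul, map_mul, map_inv, mul_inv_cancel_comm, hω] at h'
      exact absurd h' (by decide)
  · exact (Int.units_eq_one_or (π ω)).resolve_right fun h =>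
      hχ ((ρ.ind R).hInd_char_odd hς h)
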